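/- Let $N\ge 1$, let $\omega$ be an open subset of the unit sphere $\mathbb S^{N-1}\subset\mathbb R^N$, and let $\Omega=\{x\in\mathbb R^N: x\neq 0,\ x/|x|\in\omega\}$ be the cone over $\omega$. Let $\phi\in C^1(\Omega)\cap C(\overline\Omega)$ with $\phi>0$ on $\Omega$. For measurable $M\subset\Omega$ put $$\nu(M)=\int_M\phi\,dx,\qquad P_\nu(M,\Omega)=\sup\Big\{\int_M \operatorname{div}(\phi\,\mathbf v)\,dx:\ \mathbf v\in C^1_c(\Omega,\mathbb R^N),\ |\mathbf v|\le 1\Big\},$$ and, for $m\ge 0$, $I_\nu(m)=\inf\{P_\nu(M,\Omega): M\subset\Omega\text{ measurable},\ \nu(M)=m\}$. Let $B_R$ be the open ball of radius $R$ centred at the origin, and suppose that for every $R>0$ $$I_\nu(m)=P_\nu(B_R\cap\Omega,\Omega)\quad\text{with } m=\nu(B_R\cap\Omega).$$ Then there are functions $A\in C^1((0,\infty))\cap C([0,\infty))$ with $A(r)>0$ for $r>0$, and $B\in C^1(\omega)$ with $B>0$ on $\omega$, such that $$\phi(r\Theta)=A(r)B(\Theta)\qquad\text{for all } r>0,\ \Theta\in\omega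 .$$ Moreover, if $\phi\in C^2(\Omega)$, then $A\in C^2((0,\infty))$ and $$\lambda(B,\omega)\ \ge\ N-1+r^2\left[\frac{A'(r)^2}{A(r)^2}-\frac{A''(r)}{A(r)}\right]\qquad\text{for all } r>0,$$ where $$\lambda(B,\omega)=\inf\left\{\frac{\int_\omega|\nabla_\Theta u|^2B\,d\Theta}{\int_\omega u^2B\,d\Theta}:\ u\in C^1(\omega),\ \int_\omega u^2B\,d\Theta<\infty,\ \int_\omega uB\,d\Theta=0,\ u\not\equiv 0\right\}\in[0,\infty].$$ Here $d\Theta$ is the surface measure and $\nabla_\Theta$ the gradient on $\mathbb S^{N-1}$; a quotient with infinite numerator is $+\infty$, and $\inf\emptyset=+\infty$. -/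

import Mathlib

open Set MeasureTheory Metric
open scoped ENNReal Manifold

noncomputable section

/-- The Euclidean space of dimension `N`. -/
abbrev Euc (N : ℕ) : Type := EuclideanSpace ℝ (Fin N)

/-- The unit sphere `S^{N-1}` of the `N`-dimensional Euclidean space. -/
abbrev USphere (N : ℕ) : Type := sphere (0 : Euc N) 1

/-- The cone `{x ≠ 0 : x / |x| ∈ ω}` over a subset `ω` of the unit sphere. -/
def coneOver {N : ℕ} (ω : Set (USphere N)) : Set (Euc N) :=
  {x | x ≠ 0 ∧ ‖x‖⁻¹ • x ∈ (Subtype.val '' ω : Set (Euc N))}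

/-- The measure `dν = φ(x) dx` on the open set `Ω`. -/
def weightedMeasure {N : ℕ} (φ : Euc N → ℝ) (Ω : Set (Euc N)) : Measure (Euc N) :=
  (volume.restrict Ω).withDensity (fun x => ENNReal.ofReal (φ x))

/-- The divergence of a vector field: the sum of the partial derivatives `∂ᵢ Fᵢ`. -/
def divergence {N : ℕ} (F : Euc N → Euc N) (x : Euc N) : ℝ :=
  ∑ i : Fin N, fderiv ℝ (fun y => F y i) x (EuclideanSpace.single i 1)

/-- The class of `C¹` vector fields, compactly supported in `Ω`, with `|v| ≤ 1`. -/
def IsTestField {N : ℕ} (Ω : Set (Euc N)) (v : Euc N → Euc N) : Prop :=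
  ContDiff ℝ 1 v ∧ HasCompactSupport v ∧ tsupport v ⊆ Ω ∧ ∀ x, ‖v x‖ ≤ 1

/-- The `ν`-perimeter of `M` relative to `Ω`, for `dν = φ dx`: the supremum in `[0, ∞]` of
`∫_M div (φ v) dx` over all test fields `v`. (As `v = 0` is a test field, the supremum is
nonnegative, so that truncating each integral at `0` changes nothing.) -/
def weightedPerimeter {N : ℕ} (φ : Euc N → ℝ) (M Ω : Set (Euc N)) : ℝ≥0∞ :=
  ⨆ (v : Euc N → Euc N) (_ : IsTestField Ω v),
    ENNReal.ofReal (∫ x in M, divergence (fun y => φ y • v y) x)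

/-- The isoperimetric function `I_ν(m)`: the infimum of `P_ν(M, Ω)` over all measurable
`M ⊆ Ω` with `ν(M) = m`. -/
def isoperimetricProfile {N : ℕ} (φ : Euc N → ℝ) (Ω : Set (Euc N)) (m : ℝ≥0∞) : ℝ≥0∞ :=
  ⨅ (M : Set (Euc N)) (_ : MeasurableSet M) (_ : M ⊆ Ω) (_ : weightedMeasure φ Ω M = m),
    weightedPerimeter φ M Ω

open Classical in
/-- The extension `x ↦ u(x / |x|)` of a function on the unit sphere, homogeneous of degree
zero (with value `0` at the origin). -/
def homogeneousExt {N : ℕ} (u : USphere N → ℝ) (x : Euc N) : ℝ :=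
  if h : x = 0 then 0
  else u ⟨‖x‖⁻¹ • x, by
    rw [mem_sphere_zero_iff_norm, norm_smul, norm_inv, norm_norm,
      inv_mul_cancel₀ (norm_ne_zero_iff.mpr h)]⟩

/-- The gradient `∇_Θ u` on the unit sphere, as a vector of the ambient space: the gradient at
`θ` of the extension of `u` that is constant along rays. -/
def sphericalGradient {N : ℕ} (u : USphere N → ℝ) (θ : USphere N) : Euc N :=
  gradient (homogeneousExt u) (θ : Euc N)

/-- The surface measure `dΘ` on the unit sphere. -/
abbrev surfaceMeasure (N : ℕ) : Measure (USphere N) :=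
  (volume : Measure (Euc N)).toSphere

/-- `u` is admissible for the eigenvalue problem: `u ∈ C¹(ω)`, `∫_ω u² B dΘ` is finite,
`∫_ω u B dΘ = 0` (with an integrable integrand) and `u` does not vanish identically on `ω`.
The sphere in dimension `n + 1` carries its standard structure of an `n`-manifold. -/
def IsNeumannTrial {n : ℕ} (B : USphere (n + 1) → ℝ) (ω : Set (USphere (n + 1)))
    (u : USphere (n + 1) → ℝ) : Prop :=
  ContMDiffOn (𝓡 n) 𝓘(ℝ, ℝ) 1 u ω ∧
  IntegrableOn (fun θ => u θ ^ 2 * B θ) ω (surfaceMeasure (n + 1)) ∧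
  IntegrableOn (fun θ => u θ * B θ) ω (surfaceMeasure (n + 1)) ∧
  ∫ θ in ω, u θ * B θ ∂(surfaceMeasure (n + 1)) = 0 ∧
  ∃ θ ∈ ω, u θ ≠ 0

/-- The first nontrivial Neumann eigenvalue `λ(B, ω)`, the infimum in `[0, ∞]` of the quotients
`∫_ω |∇_Θ u|² B dΘ / ∫_ω u² B dΘ` over all admissible `u`. The numerator may be infinite;
the infimum of the empty set is `∞`. -/
def neumannEigenvalue {n : ℕ} (B : USphere (n + 1) → ℝ) (ω : Set (USphere (n + 1))) : ℝ≥0∞ :=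
  ⨅ (u : USphere (n + 1) → ℝ) (_ : IsNeumannTrial B ω u),
    (∫⁻ θ in ω, ENNReal.ofReal (‖sphericalGradient u θ‖ ^ 2 * B θ) ∂(surfaceMeasure (n + 1))) /
      (∫⁻ θ in ω, ENNReal.ofReal (u θ ^ 2 * B θ) ∂(surfaceMeasure (n + 1)))

end

/-!
Write `f(r, θ) = rⁿ φ(r θ)` for the density of the weighted measure in polar coordinates. A radial
graph `{|x| < q(x)}`, with `q` positive, `C¹` and constant along rays, has mass `∫_ω ∫₀^q f dr dΘ`
and perimeter at most `∫_ω f(q, θ) (1 + |∇q|² / (2 q²)) dΘ`, while the ball of radius `R` has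
perimeter at least `∫_ω f(R, θ) dΘ`. Hence, if balls are isoperimetric, every graph with the mass
of the ball satisfies

  `∫_ω f(R, θ) dΘ ≤ ∫_ω f(q, θ) (1 + |∇q|² / (2 q²)) dΘ`

(`lintegral_radialDensity_le_of_mass_eq`); everything else is derived from this inequality. The
perimeter bounds rest on a divergence theorem for radial graphs
(`setIntegral_divergence_sublevel`), obtained by integrating by parts against smooth functions of
the homogeneous function `|x| / q` that approximate the indicator of the graph, and passing to the
limit in polar coordinates.

First variation. Let `q = R + t U₁ + s U₂`, where `U₁`, `U₂` are bump functions with disjoint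
supports and `s = s(t)` keeps the mass constant. The gradient term is of second order, so that
criticality of `t = 0` gives `∫ ∂ᵣf U₁ / ∫ f U₁ = ∫ ∂ᵣf U₂ / ∫ f U₂` at `r = R`. This
is impossible if `∂ᵣf / f < c` on the first support and `∂ᵣf / f > c` on the second one. So
`∂ᵣf / f` does not depend on `θ` (`not_radialDensityDeriv_lt`, `radialDensityDeriv_mul_comm`), and
the quotient of `φ` along two rays is constant (`eq_mul_div_of_isoperimetric`). This is the product
structure, with `A(r) = φ(r θ₀)` and `B = φ / φ(θ₀)`.

Second variation. Now `f(r, θ) = a(r) B(θ)` with `a = rⁿ A`. Let `G` be the primitive of `a`. For a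
bounded function `U` with `∫ U B = 0`, the graph of `q = G⁻¹(G(R) + t U)` has exactly the mass of
the ball. By the second-derivative test, `a` as a function of `G` lies below a parabola
(`eventually_le_quadratic`), and comparing the terms of order `t²` gives

  `- R² (a' / a)'(R) ∫ U² B ≤ ∫ |∇U|² B`

(`second_variation_of_bounded`). As `a' / a = n / r + A' / A`, the constant is the one asserted.
Trial functions need not be bounded; `poincare_of_bounded` removes this restriction by smooth
truncation and subtraction of the mean.
-/

open Filter Topology

variable {n : ℕ} {ω : Set (USphere (n + 1))}

/-! ### The cone over a subset of the sphere -/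

theorem USphere.norm_coe {N : ℕ} (θ : USphere N) : ‖(θ : Euc N)‖ = 1 :=
  mem_sphere_zero_iff_norm.1 θ.2

theorem USphere.coe_ne_zero {N : ℕ} (θ : USphere N) : (θ : Euc N) ≠ 0 :=
  norm_ne_zero_iff.1 (by rw [θ.norm_coe]; exact one_ne_zero)

theorem norm_smul_sphere {N : ℕ} {r : ℝ} (hr : 0 ≤ r) (θ : USphere N) :
    ‖r • (θ : Euc N)‖ = r := by
  rw [norm_smul, θ.norm_coe, mul_one, Real.norm_of_nonneg hr]

theorem smul_mem_coneOver {N : ℕ} {ω : Set (USphere N)} {r : ℝ} (hr : 0 < r) (θ : USphere N) :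
    r • (θ : Euc N) ∈ coneOver ω ↔ θ ∈ ω := by
  have h : ‖r • (θ : Euc N)‖⁻¹ • r • (θ : Euc N) = θ := by
    rw [norm_smul_sphere hr.le, inv_smul_smul₀ hr.ne']
  simp only [coneOver, mem_ofPred_eq, h]
  constructor
  · rintro ⟨-, θ', h', e⟩
    rwa [← Subtype.ext e]
  · exact fun hθ => ⟨smul_ne_zero hr.ne' θ.coe_ne_zero, θ, hθ, rfl⟩

theorem coe_mem_coneOver {N : ℕ} {ω : Set (USphere N)} (θ : USphere N) :
    (θ : Euc N) ∈ coneOver ω ↔ θ ∈ ω := by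
  simpa using smul_mem_coneOver (ω := ω) one_pos θ

theorem exists_of_mem_coneOver {N : ℕ} {ω : Set (USphere N)} {x : Euc N}
    (hx : x ∈ coneOver ω) : ∃ θ ∈ ω, x = ‖x‖ • (θ : Euc N) := by
  obtain ⟨h0, θ, hθ, e⟩ := hx
  exact ⟨θ, hθ, by rw [e, smul_inv_smul₀ (norm_ne_zero_iff.2 h0)]⟩

theorem smul_mem_coneOver_of_mem {N : ℕ} {ω : Set (USphere N)} {x : Euc N}
    (hx : x ∈ coneOver ω) {r : ℝ} (hr : 0 < r) : r • x ∈ coneOver ω := by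
  obtain ⟨θ, hθ, e⟩ := exists_of_mem_coneOver hx
  rw [e, smul_smul]
  exact (smul_mem_coneOver (mul_pos hr (norm_pos_iff.2 hx.1)) θ).2 hθ

theorem isOpen_coneOver {N : ℕ} {ω : Set (USphere N)} (hω : IsOpen ω) :
    IsOpen (coneOver ω) := by
  obtain ⟨O, hO, rfl⟩ := isOpen_induced_iff.1 hω
  have : coneOver (Subtype.val ⁻¹' O : Set (USphere N)) =
      {x : Euc N | x ≠ 0} ∩ (fun x : Euc N => ‖x‖⁻¹ • x) ⁻¹' O := by
    ext x
    simp only [coneOver, mem_ofPred_eq, mem_inter_iff, mem_preimage, mem_image]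
    refine and_congr_right fun hx => ⟨?_, fun h => ⟨⟨‖x‖⁻¹ • x, ?_⟩, h, rfl⟩⟩
    · rintro ⟨θ, h, e⟩
      rwa [← e]
    · rw [mem_sphere_zero_iff_norm, norm_smul, norm_inv, norm_norm,
        inv_mul_cancel₀ (norm_ne_zero_iff.mpr hx)]
  rw [this]
  refine ContinuousOn.isOpen_inter_preimage ?_ isOpen_ne hO
  exact (continuous_norm.continuousOn.inv₀ fun x hx => norm_ne_zero_iff.2 hx).smul continuousOn_id

/-! ### Polar coordinates -/

/-- Polar coordinates: Lebesgue measure is the image of `dΘ ⊗ rⁿ dr` on `S × (0, ∞)` under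
`(θ, r) ↦ r θ`. The second factor is kept as a measure on `ℝ`, so that no subtypes occur. -/
theorem map_polar_eq_volume (n : ℕ) :
    Measure.map (fun p : USphere (n + 1) × ℝ => p.2 • (p.1 : Euc (n + 1)))
      ((surfaceMeasure (n + 1)).prod
        ((volume.restrict (Ioi 0)).withDensity fun r : ℝ => ENNReal.ofReal (r ^ n))) =
      (volume : Measure (Euc (n + 1))) := by
  have hd : Module.finrank ℝ (Euc (n + 1)) - 1 = n := by simp
  have h1 : (volume.restrict (Ioi 0)).withDensity (fun r : ℝ => ENNReal.ofReal (r ^ n)) =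
      Measure.map (Subtype.val : Ioi (0 : ℝ) → ℝ) (Measure.volumeIoiPow n) := by
    ext s hs
    rw [withDensity_apply _ hs, Measure.map_apply measurable_subtype_coe hs, Measure.volumeIoiPow,
      withDensity_apply _ (measurable_subtype_coe hs),
      setLIntegral_subtype measurableSet_Ioi _ (fun r : ℝ => ENNReal.ofReal (r ^ n)),
      Measure.restrict_restrict hs, Subtype.image_preimage_coe, inter_comm]
  have h2 := (volume : Measure (Euc (n + 1))).measurePreserving_homeomorphUnitSphereProd
  rw [hd] at h2
  have h3 := h2.symm (homeomorphUnitSphereProd (Euc (n + 1))).toMeasurableEquiv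
  have h4 : Measure.map (Subtype.val : ({0}ᶜ : Set (Euc (n + 1))) → Euc (n + 1))
      ((volume : Measure (Euc (n + 1))).comap (↑)) = volume := by
    rw [(MeasurableEmbedding.subtype_coe (measurableSet_singleton _).compl).map_comap,
      Subtype.range_coe, restrict_compl_singleton]
  have h5 : (surfaceMeasure (n + 1)).prod
      (Measure.map (Subtype.val : Ioi (0 : ℝ) → ℝ) (Measure.volumeIoiPow n)) =
      Measure.map (Prod.map id Subtype.val)
        ((surfaceMeasure (n + 1)).prod (Measure.volumeIoiPow n)) := by
    rw [← Measure.map_prod_map _ _ measurable_id measurable_subtype_coe, Measure.map_id]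
  rw [h1, h5, Measure.map_map (by fun_prop) (by fun_prop)]
  rw [← h4, ← h3.map_eq, Measure.map_map measurable_subtype_coe h3.measurable]
  congr 1

theorem lintegral_polar (g : Euc (n + 1) → ℝ≥0∞) (hg : Measurable g) :
    ∫⁻ x, g x = ∫⁻ θ, ∫⁻ r in Ioi (0 : ℝ), ENNReal.ofReal (r ^ n) * g (r • (θ : Euc (n + 1)))
      ∂volume ∂(surfaceMeasure (n + 1)) := by
  have hm : Measurable fun p : USphere (n + 1) × ℝ => p.2 • (p.1 : Euc (n + 1)) := by fun_prop
  rw [← map_polar_eq_volume n, lintegral_map hg hm,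
    lintegral_prod (fun p : USphere (n + 1) × ℝ => g (p.2 • (p.1 : Euc (n + 1))))
      (hg.comp hm).aemeasurable]
  refine lintegral_congr fun θ => ?_
  rw [lintegral_withDensity_eq_lintegral_mul _ (by fun_prop)
    (by fun_prop : Measurable fun r : ℝ => g (r • (θ : Euc (n + 1))))]
  rfl

theorem integral_withDensity_pow {n : ℕ} (F : ℝ → ℝ) :
    ∫ r, F r ∂((volume.restrict (Ioi 0)).withDensity fun r : ℝ => ENNReal.ofReal (r ^ n)) =
      ∫ r in Ioi (0 : ℝ), r ^ n * F r := by
  rw [integral_withDensity_eq_integral_toReal_smul (by fun_prop) (by simp)]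
  refine setIntegral_congr_fun measurableSet_Ioi fun r hr => ?_
  simp only [smul_eq_mul]
  rw [ENNReal.toReal_ofReal (pow_nonneg (le_of_lt hr) n)]

theorem integral_polar {g : Euc (n + 1) → ℝ} (hg : Integrable g) :
    Integrable (fun θ : USphere (n + 1) => ∫ r in Ioi (0 : ℝ), r ^ n * g (r • (θ : Euc (n + 1))))
      (surfaceMeasure (n + 1)) ∧
    ∫ x, g x = ∫ θ, ∫ r in Ioi (0 : ℝ), r ^ n * g (r • (θ : Euc (n + 1)))
      ∂volume ∂(surfaceMeasure (n + 1)) := by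
  have hm : Measurable fun p : USphere (n + 1) × ℝ => p.2 • (p.1 : Euc (n + 1)) := by fun_prop
  rw [← map_polar_eq_volume n] at hg ⊢
  have hi := (integrable_map_measure hg.1 hm.aemeasurable).1 hg
  have h2 : ∀ θ : USphere (n + 1), ∫ r in Ioi (0 : ℝ), r ^ n * g (r • (θ : Euc (n + 1))) =
      ∫ r, g (r • (θ : Euc (n + 1)))
        ∂((volume.restrict (Ioi 0)).withDensity fun r : ℝ => ENNReal.ofReal (r ^ n)) :=
    fun θ => (integral_withDensity_pow _).symm
  constructor
  · simp_rw [h2]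
    exact hi.integral_prod_left
  · simp_rw [h2]
    rw [integral_map hm.aemeasurable hg.1]
    exact integral_prod _ hi

/-! ### Extension of functions from the sphere to the cone -/

theorem homogeneousExt_smul_coe (u : USphere (n + 1) → ℝ) {r : ℝ} (hr : 0 < r)
    (θ : USphere (n + 1)) : homogeneousExt u (r • (θ : Euc (n + 1))) = u θ := by
  rw [homogeneousExt, dif_neg (smul_ne_zero hr.ne' θ.coe_ne_zero)]
  congr 1
  exact Subtype.ext (by simp only [norm_smul_sphere hr.le, inv_smul_smul₀ hr.ne'])

theorem homogeneousExt_coe (u : USphere (n + 1) → ℝ) (θ : USphere (n + 1)) :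
    homogeneousExt u (θ : Euc (n + 1)) = u θ := by
  simpa using homogeneousExt_smul_coe u one_pos θ

theorem homogeneousExt_smul (u : USphere (n + 1) → ℝ) {r : ℝ} (hr : 0 < r)
    (x : Euc (n + 1)) : homogeneousExt u (r • x) = homogeneousExt u x := by
  by_cases hx : x = 0
  · simp [hx]
  · have hx' : 0 < ‖x‖ := norm_pos_iff.2 hx
    let θ : USphere (n + 1) := ⟨‖x‖⁻¹ • x, by
      rw [mem_sphere_zero_iff_norm, norm_smul, norm_inv, norm_norm, inv_mul_cancel₀ hx'.ne']⟩
    have e : x = ‖x‖ • (θ : Euc (n + 1)) := (smul_inv_smul₀ hx'.ne' x).symm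
    rw [e, smul_smul, homogeneousExt_smul_coe u (mul_pos hr hx'), homogeneousExt_smul_coe u hx']

/-- A function that is `C¹` on an open subset of the manifold `Sⁿ` extends to a `C¹` function on
the cone. The manifold structure of the sphere enters only here and in the regularity of `B`. -/
theorem contDiffOn_homogeneousExt (hω : IsOpen ω) {u : USphere (n + 1) → ℝ}
    (hu : ContMDiffOn (𝓡 n) 𝓘(ℝ, ℝ) 1 u ω) :
    ContDiffOn ℝ 1 (homogeneousExt u) (coneOver ω) := by
  have : Fact (Module.finrank ℝ (Euc (n + 1)) = n + 1) := Fact.mk finrank_euclideanSpace_fin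
  let U : TopologicalSpace.Opens (Euc (n + 1)) := ⟨{x | x ≠ 0}, isOpen_ne⟩
  have hmem : ∀ x : U, ‖(x : Euc (n + 1))‖⁻¹ • (x : Euc (n + 1)) ∈ sphere (0 : Euc (n + 1)) 1 := by
    intro x
    rw [mem_sphere_zero_iff_norm, norm_smul, norm_inv, norm_norm,
      inv_mul_cancel₀ (norm_ne_zero_iff.mpr x.2)]
  have hf : ContMDiff 𝓘(ℝ, Euc (n + 1)) 𝓘(ℝ, Euc (n + 1)) 1
      (fun x : U => ‖(x : Euc (n + 1))‖⁻¹ • (x : Euc (n + 1))) := by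
    intro x
    refine (contMDiffAt_subtype_iff (f := fun x : Euc (n + 1) => ‖x‖⁻¹ • x)).2 ?_
    exact (((contDiffAt_norm ℝ x.2).inv (norm_ne_zero_iff.2 x.2)).smul contDiffAt_id).contMDiffAt
  have hp := hf.codRestrict_sphere (n := n) hmem
  intro x hx
  refine ContDiffAt.contDiffWithinAt ?_
  let x' : U := ⟨x, hx.1⟩
  have h1 : codRestrict _ _ hmem x' ∈ ω := by
    obtain ⟨-, θ, hθ, e⟩ := hx
    have : codRestrict _ _ hmem x' = θ := Subtype.ext e.symm
    rwa [this]
  have h2 : ContMDiffAt 𝓘(ℝ, Euc (n + 1)) 𝓘(ℝ, ℝ) 1 (fun y : U => homogeneousExt u y) x' := by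
    have := (hu.contMDiffAt (hω.mem_nhds h1)).comp x' hp.contMDiffAt
    refine this.congr_of_eventuallyEq (Eventually.of_forall fun y => ?_)
    simp only [homogeneousExt, dif_neg y.2, Function.comp]
    rfl
  exact (contMDiffAt_subtype_iff.1 h2).contDiffAt

/-! ### Integration by parts for fields supported in an open set -/

/-- A function that is continuous on an open set and vanishes off a closed subset of it is
continuous. It applies to products of test fields with functions that are regular on the cone
only. -/
theorem continuous_of_continuousOn_of_zero {X : Type*} [TopologicalSpace X] {f : X → ℝ}
    {Ω T : Set X} (hΩ : IsOpen Ω) (hf : ContinuousOn f Ω) (hT : IsClosed T) (hTΩ : T ⊆ Ω)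
    (h0 : ∀ x, x ∉ T → f x = 0) : Continuous f := by
  rw [continuous_iff_continuousAt]
  intro x
  by_cases hx : x ∈ T
  · exact hf.continuousAt (hΩ.mem_nhds (hTΩ hx))
  · refine (continuousAt_const (y := (0 : ℝ))).congr ?_
    filter_upwards [hT.isOpen_compl.mem_nhds hx] with y hy
    exact (h0 y hy).symm

theorem integrable_of_continuousOn_of_zero {f : Euc (n + 1) → ℝ}
    {Ω T : Set (Euc (n + 1))} (hΩ : IsOpen Ω) (hf : ContinuousOn f Ω) (hT : IsCompact T)
    (hTΩ : T ⊆ Ω) (h0 : ∀ x, x ∉ T → f x = 0) : Integrable f :=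
  (continuous_of_continuousOn_of_zero hΩ hf hT.isClosed hTΩ h0).integrable_of_hasCompactSupport
    (HasCompactSupport.intro hT fun x hx => h0 x hx)

theorem contDiff_smul_of_tsupport_subset {N : ℕ} {Ω : Set (Euc N)} (hΩ : IsOpen Ω)
    {g : Euc N → ℝ} (hg : ContDiffOn ℝ 1 g Ω) {W : Euc N → Euc N} (hW : ContDiff ℝ 1 W)
    (hs : tsupport W ⊆ Ω) : ContDiff ℝ 1 fun y => g y • W y := by
  rw [contDiff_iff_contDiffAt]
  intro x
  by_cases hx : x ∈ tsupport W
  · exact (hg.contDiffAt (hΩ.mem_nhds (hs hx))).smul hW.contDiffAt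
  · refine (contDiffAt_const (c := (0 : Euc N))).congr_of_eventuallyEq ?_
    filter_upwards [(isClosed_tsupport W).isOpen_compl.mem_nhds hx] with y hy
    rw [image_eq_zero_of_notMem_tsupport hy, smul_zero]

theorem tsupport_smul_field_subset {N : ℕ} (g : Euc N → ℝ) (W : Euc N → Euc N) :
    tsupport (fun y => g y • W y) ⊆ tsupport W :=
  closure_mono fun x hx => by
    simp only [Function.mem_support] at hx ⊢
    exact fun h => hx (by rw [h, smul_zero])

theorem divergence_eq_zero_of_notMem {N : ℕ} {W : Euc N → Euc N} {x : Euc N}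
    (hx : x ∉ tsupport W) : divergence W x = 0 := by
  refine Finset.sum_eq_zero fun i _ => ?_
  have : (fun y => W y i) =ᶠ[𝓝 x] fun _ => 0 := by
    filter_upwards [(isClosed_tsupport W).isOpen_compl.mem_nhds hx] with y hy
    rw [image_eq_zero_of_notMem_tsupport hy]; rfl
  rw [this.fderiv_eq]
  simp

theorem contDiff_coord {N : ℕ} {W : Euc N → Euc N} (hW : ContDiff ℝ 1 W) (i : Fin N) :
    ContDiff ℝ 1 fun y => W y i :=
  (EuclideanSpace.proj (𝕜 := ℝ) i).contDiff.comp hW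

theorem continuous_divergence {N : ℕ} {W : Euc N → Euc N} (hW : ContDiff ℝ 1 W) :
    Continuous (divergence W) :=
  continuous_finsetSum _ fun i _ =>
    ((contDiff_coord hW i).continuous_fderiv one_ne_zero).clm_apply continuous_const

/-- Integration by parts for the product of a function that is `C¹` on an open set with a `C¹`
field supported in that set. -/
theorem integral_mul_divergence {Ω : Set (Euc (n + 1))} (hΩ : IsOpen Ω)
    {g : Euc (n + 1) → ℝ} (hg : ContDiffOn ℝ 1 g Ω) {W : Euc (n + 1) → Euc (n + 1)}
    (hW : ContDiff ℝ 1 W) (hc : HasCompactSupport W) (hs : tsupport W ⊆ Ω) :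
    ∫ x, g x * divergence W x = -∫ x, fderiv ℝ g x (W x) := by
  have hg' : ContinuousOn (fderiv ℝ g) Ω := hg.continuousOn_fderiv_of_isOpen hΩ le_rfl
  have hz : ∀ x ∉ tsupport W, ∀ i, W x i = 0 := fun x hx i => by
    rw [image_eq_zero_of_notMem_tsupport hx]; rfl
  have hsi : ∀ i, tsupport (fun y => W y i) ⊆ tsupport W := fun i =>
    closure_mono fun x hx => by
      simp only [Function.mem_support] at hx ⊢
      exact fun h => hx (by rw [h]; rfl)
  have hz' : ∀ x ∉ tsupport W, ∀ i, fderiv ℝ (fun y => W y i) x = 0 := fun x hx i =>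
    image_eq_zero_of_notMem_tsupport fun h => hx (hsi i (tsupport_fderiv_subset ℝ h))
  have hi1 : ∀ i, Integrable fun x => fderiv ℝ g x (EuclideanSpace.single i 1) * W x i := fun i =>
    integrable_of_continuousOn_of_zero hΩ
      ((hg'.clm_apply continuousOn_const).mul (contDiff_coord hW i).continuous.continuousOn) hc hs
      fun x hx => by rw [hz x hx, mul_zero]
  have hi2 : ∀ i, Integrable fun x =>
      g x * fderiv ℝ (fun y => W y i) x (EuclideanSpace.single i 1) := fun i =>
    integrable_of_continuousOn_of_zero hΩ
      (hg.continuousOn.mul (((contDiff_coord hW i).continuous_fderiv one_ne_zero).clm_apply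
        continuous_const).continuousOn) hc hs
      fun x hx => by rw [hz' x hx]; simp
  have hi3 : ∀ i, Integrable fun x => g x * W x i := fun i =>
    integrable_of_continuousOn_of_zero hΩ
      (hg.continuousOn.mul (contDiff_coord hW i).continuous.continuousOn) hc hs
      fun x hx => by rw [hz x hx, mul_zero]
  have hsum : ∀ x, fderiv ℝ g x (W x) =
      ∑ i, fderiv ℝ g x (EuclideanSpace.single i 1) * W x i := by
    intro x
    conv_lhs => rw [← (EuclideanSpace.basisFun (Fin (n + 1)) ℝ).sum_repr (W x)]
    simp only [map_sum, map_smul, EuclideanSpace.basisFun_repr, EuclideanSpace.basisFun_apply,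
      smul_eq_mul, mul_comm]
  simp_rw [hsum, divergence, Finset.mul_sum]
  rw [integral_finsetSum _ fun i _ => hi2 i, integral_finsetSum _ fun i _ => hi1 i,
    ← Finset.sum_neg_distrib]
  refine Finset.sum_congr rfl fun i _ => ?_
  refine integral_mul_fderiv_eq_neg_fderiv_mul_of_integrable (hi1 i) (hi2 i) (hi3 i) ?_ ?_
  · intro x hx
    exact (hg.contDiffAt (hΩ.mem_nhds (hs (hsi i hx)))).differentiableAt one_ne_zero
  · exact fun x _ => (contDiff_coord hW i).differentiable one_ne_zero x

/-! ### An approximate identity on the half-line -/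

theorem deriv_smoothTransition_eq_zero {x : ℝ} (hx : x ∉ Icc (0 : ℝ) 1) :
    deriv Real.smoothTransition x = 0 := by
  rcases not_and_or.1 hx with h | h
  · have : Real.smoothTransition =ᶠ[𝓝 x] fun _ => 0 := by
      filter_upwards [Iio_mem_nhds (not_le.1 h)] with y hy
      exact Real.smoothTransition.zero_of_nonpos (le_of_lt hy)
    rw [this.deriv_eq]; simp
  · have : Real.smoothTransition =ᶠ[𝓝 x] fun _ => 1 := by
      filter_upwards [Ioi_mem_nhds (not_le.1 h)] with y hy
      exact Real.smoothTransition.one_of_one_le (le_of_lt hy)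
    rw [this.deriv_eq]; simp

theorem continuous_deriv_smoothTransition : Continuous (deriv Real.smoothTransition) :=
  (Real.smoothTransition.contDiff (n := 1)).continuous_deriv le_rfl

theorem integrable_deriv_smoothTransition : Integrable (deriv Real.smoothTransition) :=
  continuous_deriv_smoothTransition.integrable_of_hasCompactSupport
    (HasCompactSupport.intro isCompact_Icc fun _ hx => deriv_smoothTransition_eq_zero hx)

theorem integral_deriv_smoothTransition : ∫ x, deriv Real.smoothTransition x = 1 := by
  have h := integral_of_hasDerivAt_of_tendsto (f := Real.smoothTransition)
    (f' := deriv Real.smoothTransition) (m := 0) (n := 1)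
    (fun x => ((Real.smoothTransition.contDiff (n := 1)).differentiable one_ne_zero x).hasDerivAt)
    integrable_deriv_smoothTransition
    (tendsto_const_nhds.congr' (by
      filter_upwards [Iic_mem_atBot 0] with x hx
      exact (Real.smoothTransition.zero_of_nonpos hx).symm))
    (tendsto_const_nhds.congr' (by
      filter_upwards [Ici_mem_atTop 1] with x hx
      exact (Real.smoothTransition.one_of_one_le hx).symm))
  simpa using h

/-- The substitution `τ = k (1 - r h)`. For `k > 1` the integrand on the left vanishes for `r ≤ 0`,
so that the half-line can be replaced by the line. -/
theorem integral_deriv_smoothTransition_affine {k h : ℝ} (hk : 1 < k) (hh : 0 < h) (F : ℝ → ℝ) :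
    ∫ r in Ioi (0 : ℝ), k * deriv Real.smoothTransition (k * (1 - r * h)) * F r =
      h⁻¹ * ∫ τ, deriv Real.smoothTransition τ * F ((1 - τ / k) * h⁻¹) := by
  have hk0 : 0 < k := one_pos.trans hk
  rw [setIntegral_eq_integral_of_forall_compl_eq_zero]
  · set G : ℝ → ℝ := fun τ => k * deriv Real.smoothTransition τ * F ((1 - τ / k) * h⁻¹) with hG
    have h1 : ∀ r, k * deriv Real.smoothTransition (k * (1 - r * h)) * F r =
        (fun y => G (k - y)) ((k * h) * r) := by
      intro r
      simp only [hG]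
      congr 2
      · ring_nf
      · field_simp; ring
    simp_rw [h1]
    rw [Measure.integral_comp_mul_left (fun y => G (k - y)) (k * h),
      integral_sub_left_eq_self G volume k, abs_of_pos (by positivity), smul_eq_mul]
    simp only [hG, mul_assoc]
    rw [integral_const_mul]
    field_simp
  · intro r hr
    have hr' : r ≤ 0 := not_lt.1 hr
    rw [deriv_smoothTransition_eq_zero, mul_zero, zero_mul]
    intro hmem
    have : k * 1 ≤ k * (1 - r * h) := by
      gcongr
      nlinarith [mul_nonneg (neg_nonneg.2 hr') hh.le]
    linarith [hmem.2]

theorem abs_integral_deriv_smoothTransition_le {k h C : ℝ} (hk : 1 < k) (hh : 0 < h) {F : ℝ → ℝ}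
    (hF : ∀ r, |F r| ≤ C) :
    |∫ r in Ioi (0 : ℝ), k * deriv Real.smoothTransition (k * (1 - r * h)) * F r| ≤
      h⁻¹ * C * ∫ τ, |deriv Real.smoothTransition τ| := by
  rw [integral_deriv_smoothTransition_affine hk hh, abs_mul, abs_of_pos (inv_pos.2 hh), mul_assoc]
  gcongr
  rw [← integral_const_mul, ← Real.norm_eq_abs]
  refine norm_integral_le_of_norm_le (integrable_deriv_smoothTransition.abs.const_mul C)
    (Eventually.of_forall fun τ => ?_)
  rw [Real.norm_eq_abs, abs_mul, mul_comm]
  gcongr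
  exact hF _

/-- The derivative of `r ↦ -σ (k (1 - r h))`, with `σ` the smooth transition, is an approximate
identity at `r = 1 / h`; its total mass is one in the variable `r h`, whence the factor `1 / h`. -/
theorem tendsto_integral_deriv_smoothTransition {h C : ℝ} (hh : 0 < h) {F : ℝ → ℝ}
    (hF : ∀ r, |F r| ≤ C) (hc : Continuous F) :
    Tendsto (fun k : ℕ => ∫ r in Ioi (0 : ℝ),
      ((k : ℝ) + 2) * deriv Real.smoothTransition (((k : ℝ) + 2) * (1 - r * h)) * F r) atTop
      (𝓝 (h⁻¹ * F h⁻¹)) := by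
  have h1 : ∀ k : ℕ, (1 : ℝ) < (k : ℝ) + 2 := fun k => by
    have : (0 : ℝ) ≤ k := k.cast_nonneg
    linarith
  simp_rw [fun k : ℕ => integral_deriv_smoothTransition_affine (h1 k) hh F]
  refine Tendsto.const_mul _ ?_
  have h2 : F h⁻¹ = ∫ τ, deriv Real.smoothTransition τ * F h⁻¹ := by
    rw [integral_mul_const, integral_deriv_smoothTransition, one_mul]
  rw [h2]
  refine tendsto_integral_of_dominated_convergence
    (fun τ => C * |deriv Real.smoothTransition τ|) (fun k => ?_)
    (integrable_deriv_smoothTransition.abs.const_mul C) (fun k => ?_) ?_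
  · exact (continuous_deriv_smoothTransition.mul (hc.comp (by fun_prop))).aestronglyMeasurable
  · refine Eventually.of_forall fun τ => ?_
    rw [Real.norm_eq_abs, abs_mul, mul_comm]
    gcongr
    exact hF _
  · refine Eventually.of_forall fun τ => Tendsto.const_mul _ ?_
    refine (hc.tendsto _).comp ?_
    have h3 : Tendsto (fun k : ℕ => τ / ((k : ℝ) + 2)) atTop (𝓝 0) :=
      Tendsto.const_div_atTop (tendsto_atTop_add_const_right _ _ tendsto_natCast_atTop_atTop) τ
    simpa using ((tendsto_const_nhds (x := (1 : ℝ))).sub h3).mul_const h⁻¹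

/-! ### The divergence theorem on star-shaped parts of a cone -/

/-- The derivative of a function homogeneous of degree one is homogeneous of degree zero. -/
theorem fderiv_smul_of_homogeneous {Ω : Set (Euc (n + 1))} (hΩ : IsOpen Ω)
    {h : Euc (n + 1) → ℝ} (hd : DifferentiableOn ℝ h Ω) {r : ℝ} (hr : 0 < r)
    (hh : ∀ x ∈ Ω, h (r • x) = r * h x) {x : Euc (n + 1)} (hx : x ∈ Ω) (hrx : r • x ∈ Ω) :
    fderiv ℝ h (r • x) = fderiv ℝ h x := by
  have h1 : HasFDerivAt (fun y => h (r • y))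
      ((fderiv ℝ h (r • x)).comp (r • ContinuousLinearMap.id ℝ (Euc (n + 1)))) x :=
    ((hd.differentiableAt (hΩ.mem_nhds hrx)).hasFDerivAt).comp x
      ((hasFDerivAt_id x).const_smul r)
  have h2 : HasFDerivAt (fun y => h (r • y)) (r • fderiv ℝ h x) x := by
    refine ((hd.differentiableAt (hΩ.mem_nhds hx)).hasFDerivAt.const_mul r).congr_of_eventuallyEq ?_
    filter_upwards [hΩ.mem_nhds hx] with y hy using hh y hy
  have h3 := h1.unique h2
  ext v
  have h4 := congrArg (fun L : Euc (n + 1) →L[ℝ] ℝ => L v) h3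
  simp only [ContinuousLinearMap.comp_apply, smul_apply,
    ContinuousLinearMap.id_apply, map_smul, smul_eq_mul] at h4
  exact mul_left_cancel₀ hr.ne' h4

/-- The divergence theorem on the part `{h < 1}` of a cone, for a positive function `h` that is
homogeneous of degree one: in polar coordinates the surface `{h = 1}` is the radial graph of `1/h`
over `ω`. -/
theorem setIntegral_divergence_sublevel (hω : IsOpen ω) {h : Euc (n + 1) → ℝ}
    (hh : ContDiffOn ℝ 1 h (coneOver ω)) (hpos : ∀ x ∈ coneOver ω, 0 < h x)
    (hhom : ∀ x ∈ coneOver ω, ∀ r : ℝ, 0 < r → h (r • x) = r * h x)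
    {W : Euc (n + 1) → Euc (n + 1)} (hW : ContDiff ℝ 1 W) (hc : HasCompactSupport W)
    (hs : tsupport W ⊆ coneOver ω) :
    Integrable (fun θ : USphere (n + 1) => (h θ)⁻¹ * (((h θ)⁻¹) ^ n *
        fderiv ℝ h θ (W ((h θ)⁻¹ • (θ : Euc (n + 1)))))) ((surfaceMeasure (n + 1)).restrict ω) ∧
    ∫ x in {x ∈ coneOver ω | h x < 1}, divergence W x =
      ∫ θ in ω, (h θ)⁻¹ * (((h θ)⁻¹) ^ n * fderiv ℝ h θ (W ((h θ)⁻¹ • (θ : Euc (n + 1)))))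
        ∂(surfaceMeasure (n + 1)) := by
  set Ω := coneOver ω with hΩdef
  have hΩ : IsOpen Ω := isOpen_coneOver hω
  have hh' : ContinuousOn (fderiv ℝ h) Ω := hh.continuousOn_fderiv_of_isOpen hΩ le_rfl
  have hWc : Continuous W := hW.continuous
  -- the approximations `g k ∘ h` of the indicator of `{h < 1}`
  -- (the factor is `k + 2` rather than `k` because the affine substitution needs a factor `> 1`)
  let g : ℕ → ℝ → ℝ := fun k s => Real.smoothTransition (((k : ℝ) + 2) * (1 - s))
  have hg1 : ∀ k, ContDiff ℝ 1 (g k) := fun k =>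
    (Real.smoothTransition.contDiff (n := 1)).comp (by fun_prop)
  have hg2 : ∀ k s, HasDerivAt (g k)
      (-(((k : ℝ) + 2) * deriv Real.smoothTransition (((k : ℝ) + 2) * (1 - s)))) s := by
    intro k s
    have h1 : HasDerivAt (fun s : ℝ => ((k : ℝ) + 2) * (1 - s)) (((k : ℝ) + 2) * (-1)) s :=
      ((hasDerivAt_id s).const_sub 1).const_mul _
    have h2 := ((Real.smoothTransition.contDiff (n := 1)).differentiable one_ne_zero
      (((k : ℝ) + 2) * (1 - s))).hasDerivAt.comp s h1
    exact h2.congr_deriv (by ring)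
  let H : ℕ → Euc (n + 1) → ℝ := fun k x =>
    ((k : ℝ) + 2) * deriv Real.smoothTransition (((k : ℝ) + 2) * (1 - h x)) * fderiv ℝ h x (W x)
  have hHint : ∀ k, Integrable (H k) := fun k => by
    refine integrable_of_continuousOn_of_zero hΩ ?_ hc hs fun x hx => ?_
    · refine ContinuousOn.mul (continuousOn_const.mul
        (continuous_deriv_smoothTransition.comp_continuousOn ?_))
        (hh'.clm_apply hWc.continuousOn)
      exact continuousOn_const.mul (continuousOn_const.sub hh.continuousOn)
    · simp only [H, image_eq_zero_of_notMem_tsupport hx, map_zero, mul_zero]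
  have hIBP : ∀ k, ∫ x, g k (h x) * divergence W x = ∫ x, H k x := by
    intro k
    rw [integral_mul_divergence (g := fun x => g k (h x)) hΩ ((hg1 k).comp_contDiffOn hh) hW hc hs,
      ← integral_neg]
    refine integral_congr_ae (Eventually.of_forall fun x => ?_)
    by_cases hx : x ∈ tsupport W
    · have hd := (hh.differentiableOn one_ne_zero).differentiableAt (hΩ.mem_nhds (hs hx))
      have h1 := (hg2 k (h x)).comp_hasFDerivAt x hd.hasFDerivAt
      have h2 : fderiv ℝ (fun x => g k (h x)) x = _ := h1.fderiv
      simp only [H, h2, smul_apply, smul_eq_mul]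
      ring
    · simp only [H, image_eq_zero_of_notMem_tsupport hx, map_zero, mul_zero, neg_zero]
  have hdz : ∀ x, x ∉ tsupport W → divergence W x = 0 := fun x hx =>
    divergence_eq_zero_of_notMem hx
  have hSm : MeasurableSet {x ∈ Ω | h x < 1} :=
    (hh.continuousOn.isOpen_inter_preimage hΩ isOpen_Iio).measurableSet
  have hL : Tendsto (fun k => ∫ x, g k (h x) * divergence W x) atTop
      (𝓝 (∫ x in {x ∈ Ω | h x < 1}, divergence W x)) := by
    rw [← integral_indicator hSm]
    refine tendsto_integral_of_dominated_convergence (fun x => |divergence W x|) (fun k => ?_) ?_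
      (fun k => ?_) ?_
    · refine (integrable_of_continuousOn_of_zero hΩ ?_ hc hs fun x hx => ?_).aestronglyMeasurable
      · exact ((hg1 k).continuous.comp_continuousOn hh.continuousOn).mul
          (continuous_divergence hW).continuousOn
      · rw [hdz x hx, mul_zero]
    · exact (integrable_of_continuousOn_of_zero hΩ
        (continuous_divergence hW).continuousOn hc hs hdz).abs
    · refine Eventually.of_forall fun x => ?_
      rw [Real.norm_eq_abs, abs_mul, abs_of_nonneg (Real.smoothTransition.nonneg _)]
      exact mul_le_of_le_one_left (abs_nonneg _) (Real.smoothTransition.le_one _)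
    · refine Eventually.of_forall fun x => ?_
      by_cases hx : x ∈ tsupport W
      · by_cases h1 : h x < 1
        · rw [indicator_of_mem (show x ∈ {x ∈ Ω | h x < 1} from ⟨hs hx, h1⟩)]
          refine tendsto_const_nhds.congr' ?_
          have h2 : Tendsto (fun k : ℕ => ((k : ℝ) + 2) * (1 - h x)) atTop atTop :=
            (tendsto_atTop_add_const_right _ _ tendsto_natCast_atTop_atTop).atTop_mul_const
              (sub_pos.2 h1)
          filter_upwards [h2.eventually_ge_atTop 1] with k hk
          simp only [g, Real.smoothTransition.one_of_one_le hk, one_mul]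
        · rw [indicator_of_notMem (fun h' : x ∈ {x ∈ Ω | h x < 1} => h1 h'.2)]
          refine tendsto_const_nhds.congr fun k => ?_
          simp only [g]
          rw [Real.smoothTransition.zero_of_nonpos, zero_mul]
          exact mul_nonpos_of_nonneg_of_nonpos (by positivity) (by linarith)
      · have : indicator {x ∈ Ω | h x < 1} (divergence W) x = 0 := by
          rw [indicator_apply_eq_zero]; exact fun _ => hdz x hx
        rw [this]
        simp only [hdz x hx, mul_zero]
        exact tendsto_const_nhds
  -- polar coordinates on the right-hand sides
  let F : USphere (n + 1) → ℝ → ℝ := fun θ r =>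
    r ^ n * fderiv ℝ h θ (W (r • (θ : Euc (n + 1))))
  let J : ℕ → USphere (n + 1) → ℝ := fun k θ => ∫ r in Ioi (0 : ℝ),
    ((k : ℝ) + 2) * deriv Real.smoothTransition (((k : ℝ) + 2) * (1 - r * h θ)) * F θ r
  have hJ : ∀ k, ∀ θ ∈ ω, ∫ r in Ioi (0 : ℝ), r ^ n * H k (r • (θ : Euc (n + 1))) = J k θ := by
    intro k θ hθ
    have hθ' : (θ : Euc (n + 1)) ∈ Ω := (coe_mem_coneOver θ).2 hθ
    refine setIntegral_congr_fun measurableSet_Ioi fun r (hr : 0 < r) => ?_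
    simp only [H, F]
    rw [hhom θ hθ' r hr, fderiv_smul_of_homogeneous hΩ (hh.differentiableOn one_ne_zero) hr
      (fun x hx => hhom x hx r hr) hθ' (smul_mem_coneOver_of_mem hθ' hr)]
    ring
  have hJ0 : ∀ k, ∀ θ ∉ ω, ∫ r in Ioi (0 : ℝ), r ^ n * H k (r • (θ : Euc (n + 1))) = 0 := by
    intro k θ hθ
    refine setIntegral_eq_zero_of_forall_eq_zero fun r (hr : 0 < r) => ?_
    have : r • (θ : Euc (n + 1)) ∉ tsupport W := fun h' =>
      hθ ((smul_mem_coneOver hr θ).1 (hs h'))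
    simp only [H, image_eq_zero_of_notMem_tsupport this, map_zero, mul_zero]
  have hHJ : ∀ k, ∫ x, H k x = ∫ θ in ω, J k θ ∂(surfaceMeasure (n + 1)) := by
    intro k
    rw [(integral_polar (hHint k)).2,
      ← setIntegral_eq_integral_of_forall_compl_eq_zero (s := ω) (fun θ hθ => hJ0 k θ hθ)]
    exact setIntegral_congr_fun hω.measurableSet fun θ hθ => hJ k θ hθ
  have hJm : ∀ k, AEStronglyMeasurable (J k) ((surfaceMeasure (n + 1)).restrict ω) := by
    intro k
    refine ((integral_polar (hHint k)).1.aestronglyMeasurable.restrict (s := ω)).congr ?_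
    filter_upwards [ae_restrict_mem hω.measurableSet] with θ hθ using hJ k θ hθ
  -- a bound for the inner integrals that is uniform in `k` and `θ`: they vanish unless `θ` lies in
  -- the compact radial projection `K` of the support of `W`
  obtain ⟨C₁, hC₁⟩ :=
    (hc.smul_left (f := fun x : Euc (n + 1) => ‖x‖ ^ n)).exists_bound_of_continuous
    ((continuous_norm.pow n).smul hWc)
  have hC₁0 : 0 ≤ C₁ := (norm_nonneg _).trans (hC₁ 0)
  have hF : ∀ θ r, |F θ r| ≤ ‖fderiv ℝ h θ‖ * C₁ := by
    intro θ r
    have h1 := hC₁ (r • (θ : Euc (n + 1)))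
    simp only [Pi.smul_apply', norm_smul, norm_pow, norm_norm, USphere.norm_coe, mul_one] at h1
    simp only [F]
    rw [abs_mul, abs_pow, ← Real.norm_eq_abs r, ← Real.norm_eq_abs]
    calc ‖r‖ ^ n * ‖fderiv ℝ h θ (W (r • (θ : Euc (n + 1))))‖
        ≤ ‖r‖ ^ n * (‖fderiv ℝ h θ‖ * ‖W (r • (θ : Euc (n + 1)))‖) := by
          gcongr; exact ContinuousLinearMap.le_opNorm _ _
      _ = ‖fderiv ℝ h θ‖ * (‖r‖ ^ n * ‖W (r • (θ : Euc (n + 1)))‖) := by ring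
      _ ≤ _ := by gcongr
  have hFc : ∀ θ, Continuous (F θ) := fun θ => by
    simp only [F]; fun_prop
  set K : Set (Euc (n + 1)) := (fun x : Euc (n + 1) => ‖x‖⁻¹ • x) '' tsupport W with hKdef
  have hK : IsCompact K := by
    refine IsCompact.image_of_continuousOn hc ?_
    exact (continuous_norm.continuousOn.inv₀ fun x hx => norm_ne_zero_iff.2 (hs hx).1).smul
      continuousOn_id
  have hKΩ : K ⊆ Ω := by
    rintro _ ⟨x, hx, rfl⟩
    exact smul_mem_coneOver_of_mem (hs hx) (inv_pos.2 (norm_pos_iff.2 (hs hx).1))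
  obtain ⟨C₂, hC₂⟩ := hK.exists_bound_of_continuousOn
    (f := fun x => (h x)⁻¹ * ‖fderiv ℝ h x‖)
    (((hh.continuousOn.mono hKΩ).inv₀ fun x hx => (hpos x (hKΩ hx)).ne').mul
      (hh'.mono hKΩ).norm)
  set I₀ := ∫ τ, |deriv Real.smoothTransition τ| with hI₀
  have hI₀0 : 0 ≤ I₀ := integral_nonneg fun _ => abs_nonneg _
  have hk1 : ∀ k : ℕ, (1 : ℝ) < (k : ℝ) + 2 := fun k => by
    have : (0 : ℝ) ≤ k := k.cast_nonneg
    linarith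
  have hJb : ∀ k, ∀ θ ∈ ω, ‖J k θ‖ ≤ |C₂| * C₁ * I₀ := by
    intro k θ hθ
    have hθ' : (θ : Euc (n + 1)) ∈ Ω := (coe_mem_coneOver θ).2 hθ
    by_cases hθK : (θ : Euc (n + 1)) ∈ K
    · have h1 := abs_integral_deriv_smoothTransition_le (hk1 k) (hpos θ hθ') (hF θ)
      refine h1.trans ?_
      rw [← mul_assoc]
      gcongr
      exact (le_abs_self _).trans ((hC₂ θ hθK).trans (le_abs_self _))
    · have : J k θ = 0 := by
        refine setIntegral_eq_zero_of_forall_eq_zero fun r (hr : 0 < r) => ?_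
        have : r • (θ : Euc (n + 1)) ∉ tsupport W := fun h' => hθK
          ⟨_, h', by simp only [norm_smul_sphere hr.le, inv_smul_smul₀ hr.ne']⟩
        simp only [F, image_eq_zero_of_notMem_tsupport this, map_zero, mul_zero]
      rw [this, norm_zero]
      positivity
  have hJlim : ∀ θ ∈ ω, Tendsto (fun k => J k θ) atTop (𝓝 ((h θ)⁻¹ * F θ (h θ)⁻¹)) :=
    fun θ hθ => tendsto_integral_deriv_smoothTransition (hpos θ ((coe_mem_coneOver θ).2 hθ))
      (hF θ) (hFc θ)
  have hlim_ae : ∀ᵐ θ ∂((surfaceMeasure (n + 1)).restrict ω),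
      Tendsto (fun k => J k θ) atTop (𝓝 ((h θ)⁻¹ * F θ (h θ)⁻¹)) := by
    filter_upwards [ae_restrict_mem hω.measurableSet] with θ hθ using hJlim θ hθ
  constructor
  · refine Integrable.of_bound (aestronglyMeasurable_of_tendsto_ae atTop hJm hlim_ae)
      (|C₂| * C₁ * I₀) ?_
    filter_upwards [ae_restrict_mem hω.measurableSet] with θ hθ
    exact le_of_tendsto (hJlim θ hθ).norm (Eventually.of_forall fun k => hJb k θ hθ)
  · have hR : Tendsto (fun k => ∫ θ in ω, J k θ ∂(surfaceMeasure (n + 1))) atTop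
        (𝓝 (∫ θ in ω, (h θ)⁻¹ * F θ (h θ)⁻¹ ∂(surfaceMeasure (n + 1)))) := by
      refine tendsto_integral_of_dominated_convergence (fun _ => |C₂| * C₁ * I₀) hJm
        (integrable_const _) (fun k => ?_) hlim_ae
      filter_upwards [ae_restrict_mem hω.measurableSet] with θ hθ using hJb k θ hθ
    refine tendsto_nhds_unique hL (hR.congr fun k => ?_)
    rw [hIBP k, hHJ k]

/-! ### Radial subgraphs: measure and perimeter -/

theorem ofReal_integral_le_lintegral {α : Type*} [MeasurableSpace α] {μ : Measure α} {f : α → ℝ}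
    (hf : Integrable f μ) : ENNReal.ofReal (∫ x, f x ∂μ) ≤ ∫⁻ x, ENNReal.ofReal (f x) ∂μ := by
  rw [integral_eq_lintegral_pos_part_sub_lintegral_neg_part hf]
  refine (ENNReal.ofReal_le_ofReal (sub_le_self _ ENNReal.toReal_nonneg)).trans ?_
  exact ENNReal.ofReal_toReal_le

theorem measurable_indicator_of_continuousOn {N : ℕ} {Ω : Set (Euc N)} (hΩ : IsOpen Ω)
    {φ : Euc N → ℝ} (hφ : ContinuousOn φ Ω) : Measurable (Ω.indicator φ) := by
  classical
  rw [← piecewise_eq_indicator]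
  exact hφ.measurable_piecewise continuousOn_const hΩ.measurableSet

/-- The part of the cone over `ω` below the radial graph of `q`. -/
def radialSubgraph (ω : Set (USphere (n + 1))) (q : Euc (n + 1) → ℝ) : Set (Euc (n + 1)) :=
  {x ∈ coneOver ω | ‖x‖ < q x}

theorem radialSubgraph_subset (q : Euc (n + 1) → ℝ) : radialSubgraph ω q ⊆ coneOver ω :=
  fun _ hx => hx.1

theorem measurableSet_radialSubgraph (hω : IsOpen ω) {q : Euc (n + 1) → ℝ}
    (hq : ContinuousOn q (coneOver ω)) : MeasurableSet (radialSubgraph ω q) := by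
  have h := (continuous_norm.continuousOn.sub hq).isOpen_inter_preimage (isOpen_coneOver hω)
    (isOpen_Iio (a := (0 : ℝ)))
  have e : radialSubgraph ω q = coneOver ω ∩ (fun x => ‖x‖ - q x) ⁻¹' Iio 0 := by
    ext x; simp [radialSubgraph]
  rw [e]
  exact h.measurableSet

theorem ball_inter_coneOver (R : ℝ) :
    ball 0 R ∩ coneOver ω = radialSubgraph ω fun _ => R := by
  ext x
  simp [radialSubgraph, and_comm]

/-- The weighted measure of a radial subgraph in polar coordinates. -/
theorem weightedMeasure_radialSubgraph (hω : IsOpen ω) {φ q : Euc (n + 1) → ℝ}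
    (hφ : ContinuousOn φ (coneOver ω)) (hq : ContinuousOn q (coneOver ω))
    (hqhom : ∀ x ∈ coneOver ω, ∀ r : ℝ, 0 < r → q (r • x) = q x) :
    weightedMeasure φ (coneOver ω) (radialSubgraph ω q) =
      ∫⁻ θ in ω, ∫⁻ r in Ioo (0 : ℝ) (q θ), ENNReal.ofReal (r ^ n * φ (r • (θ : Euc (n + 1))))
        ∂volume ∂(surfaceMeasure (n + 1)) := by
  have hΩ := isOpen_coneOver hω
  have hM := measurableSet_radialSubgraph hω hq
  rw [weightedMeasure, withDensity_apply _ hM, Measure.restrict_restrict hM,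
    inter_eq_left.2 (radialSubgraph_subset q), ← lintegral_indicator hM]
  have h1 : (radialSubgraph ω q).indicator (fun x => ENNReal.ofReal (φ x)) =
      (radialSubgraph ω q).indicator (fun x => ENNReal.ofReal ((coneOver ω).indicator φ x)) := by
    refine indicator_congr fun x hx => ?_
    rw [indicator_of_mem (radialSubgraph_subset q hx)]
  rw [lintegral_polar]
  · rw [← setLIntegral_eq_of_support_subset (s := ω)]
    · refine setLIntegral_congr_fun hω.measurableSet fun θ hθ => ?_
      have hθ' : (θ : Euc (n + 1)) ∈ coneOver ω := (coe_mem_coneOver θ).2 hθ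
      rw [← lintegral_indicator measurableSet_Ioi, ← lintegral_indicator measurableSet_Ioo]
      refine lintegral_congr fun r => ?_
      by_cases hr : 0 < r
      · rw [indicator_of_mem (show r ∈ Ioi (0 : ℝ) from hr)]
        by_cases hrq : r < q θ
        · rw [indicator_of_mem (show r ∈ Ioo 0 (q θ) from ⟨hr, hrq⟩), indicator_of_mem,
            ← ENNReal.ofReal_mul (by positivity)]
          refine ⟨smul_mem_coneOver_of_mem hθ' hr, ?_⟩
          rwa [norm_smul_sphere hr.le, hqhom θ hθ' r hr]
        · rw [indicator_of_notMem (fun h => hrq h.2 : r ∉ Ioo 0 (q θ)), indicator_of_notMem,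
            mul_zero]
          rintro ⟨-, h⟩
          rw [norm_smul_sphere hr.le, hqhom θ hθ' r hr] at h
          exact hrq h
      · rw [indicator_of_notMem (show r ∉ Ioi (0 : ℝ) from hr),
          indicator_of_notMem (fun h => hr h.1 : r ∉ Ioo 0 (q θ))]
    · intro θ hθ
      by_contra hθω
      refine hθ ?_
      refine setLIntegral_eq_zero measurableSet_Ioi fun r (hr : 0 < r) => ?_
      rw [indicator_of_notMem fun h => hθω ((smul_mem_coneOver hr θ).1 h.1), mul_zero]
      rfl
  · rw [h1]
    exact (measurable_indicator_of_continuousOn hΩ hφ).ennreal_ofReal.indicator hM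

/-- The derivative of `x ↦ |x| / q(x)`, the function whose unit level set is the graph of `q`. -/
theorem hasFDerivAt_norm_div (q : Euc (n + 1) → ℝ) (θ : USphere (n + 1))
    (hq : DifferentiableAt ℝ q θ) (hpos : 0 < q θ) :
    HasFDerivAt (fun x => ‖x‖ * (q x)⁻¹)
      (innerSL ℝ ((q θ)⁻¹ • (θ : Euc (n + 1)) - ((q θ) ^ 2)⁻¹ • gradient q θ))
      (θ : Euc (n + 1)) := by
  have h1 : HasFDerivAt (fun x : Euc (n + 1) => ‖x‖) (innerSL ℝ (θ : Euc (n + 1)))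
      (θ : Euc (n + 1)) := by
    have h2 := (hasStrictFDerivAt_norm_sq (θ : Euc (n + 1))).hasFDerivAt.sqrt
      (by rw [θ.norm_coe]; norm_num)
    simp only [θ.norm_coe, Real.sqrt_sq (norm_nonneg _)] at h2
    refine h2.congr_fderiv ?_
    ext v
    simp
  have h3 := h1.mul ((hasDerivAt_inv hpos.ne').comp_hasFDerivAt _ hq.hasFDerivAt)
  refine h3.congr_fderiv ?_
  ext v
  have h4 : inner ℝ (gradient q θ) v = fderiv ℝ q θ v := by
    rw [gradient, InnerProductSpace.toDual_symm_apply]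
  simp [h4]
  ring

/-- The gradient of a function that is constant along rays is tangential. -/
theorem inner_gradient_self_of_homogeneous {q : Euc (n + 1) → ℝ} {x : Euc (n + 1)}
    (hq : DifferentiableAt ℝ q x) (hhom : ∀ r : ℝ, 0 < r → q (r • x) = q x) :
    inner ℝ (gradient q x) x = 0 := by
  rw [gradient, InnerProductSpace.toDual_symm_apply]
  have h1 : HasDerivAt (fun r : ℝ => r • x) x 1 := by
    simpa using (hasDerivAt_id (1 : ℝ)).smul_const x
  have h2 : HasDerivAt (fun r : ℝ => q (r • x)) (fderiv ℝ q x x) 1 := by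
    have h3 : HasFDerivAt q (fderiv ℝ q x) ((1 : ℝ) • x) := by rw [one_smul]; exact hq.hasFDerivAt
    exact h3.comp_hasDerivAt (1 : ℝ) h1
  have h4 : HasDerivAt (fun r : ℝ => q (r • x)) 0 1 := by
    refine (hasDerivAt_const (1 : ℝ) (q x)).congr_of_eventuallyEq ?_
    filter_upwards [Ioi_mem_nhds (zero_lt_one' ℝ)] with r hr using hhom r hr
  exact h2.unique h4

/-- As the gradient of `q` is orthogonal to `θ`, the gradient of `|x| / q(x)` at `θ` has norm
`q⁻¹ √(1 + |∇q|² / q²)`; the root is estimated by `√(1 + y) ≤ 1 + y / 2`. -/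
theorem fderiv_norm_div_le {q : Euc (n + 1) → ℝ} {θ : USphere (n + 1)}
    (hq : DifferentiableAt ℝ q θ) (hpos : 0 < q θ)
    (hhom : ∀ r : ℝ, 0 < r → q (r • (θ : Euc (n + 1))) = q θ)
    {v : Euc (n + 1)} (hv : ‖v‖ ≤ 1) :
    q θ * fderiv ℝ (fun x => ‖x‖ * (q x)⁻¹) θ v ≤
      1 + ‖gradient q θ‖ ^ 2 / (2 * q θ ^ 2) := by
  rw [(hasFDerivAt_norm_div q θ hq hpos).fderiv, innerSL_apply_apply]
  set g := gradient q (θ : Euc (n + 1)) with hg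
  set z : Euc (n + 1) := (q θ)⁻¹ • (θ : Euc (n + 1)) - ((q θ) ^ 2)⁻¹ • g with hz
  have horth : inner ℝ (θ : Euc (n + 1)) g = 0 := by
    rw [real_inner_comm]; exact inner_gradient_self_of_homogeneous hq hhom
  have h1 : ‖z‖ ^ 2 = (q θ)⁻¹ ^ 2 + (((q θ) ^ 2)⁻¹ * ‖g‖) ^ 2 := by
    rw [hz, norm_sub_sq_real, inner_smul_left, inner_smul_right, horth, norm_smul, norm_smul,
      θ.norm_coe, Real.norm_of_nonneg (by positivity : 0 ≤ (q θ)⁻¹),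
      Real.norm_of_nonneg (by positivity : 0 ≤ ((q θ) ^ 2)⁻¹)]
    ring
  have h2 : (q θ * ‖z‖) ^ 2 = 1 + ‖g‖ ^ 2 / q θ ^ 2 := by
    rw [mul_pow, h1]; field_simp
  have h3 : q θ * ‖z‖ ≤ 1 + ‖g‖ ^ 2 / (2 * q θ ^ 2) := by
    refine le_of_sq_le_sq ?_ (by positivity)
    rw [h2]
    have h4 : (1 + ‖g‖ ^ 2 / (2 * q θ ^ 2)) ^ 2 =
      1 + ‖g‖ ^ 2 / q θ ^ 2 + (‖g‖ ^ 2 / (2 * q θ ^ 2)) ^ 2 := by field_simp; ring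
    rw [h4]
    linarith [sq_nonneg (‖g‖ ^ 2 / (2 * q θ ^ 2))]
  refine le_trans ?_ h3
  gcongr
  exact (real_inner_le_norm z v).trans (mul_le_of_le_one_right (norm_nonneg _) hv)

/-- The divergence theorem on a radial subgraph. -/
theorem setIntegral_divergence_radialSubgraph (hω : IsOpen ω) {q : Euc (n + 1) → ℝ}
    (hq : ContDiffOn ℝ 1 q (coneOver ω)) (hpos : ∀ x ∈ coneOver ω, 0 < q x)
    (hhom : ∀ x ∈ coneOver ω, ∀ r : ℝ, 0 < r → q (r • x) = q x)
    {W : Euc (n + 1) → Euc (n + 1)} (hW : ContDiff ℝ 1 W) (hc : HasCompactSupport W)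
    (hs : tsupport W ⊆ coneOver ω) :
    Integrable (fun θ : USphere (n + 1) => q θ ^ n * (q θ *
        fderiv ℝ (fun x => ‖x‖ * (q x)⁻¹) θ (W (q θ • (θ : Euc (n + 1))))))
        ((surfaceMeasure (n + 1)).restrict ω) ∧
    ∫ x in radialSubgraph ω q, divergence W x =
      ∫ θ in ω, q θ ^ n * (q θ * fderiv ℝ (fun x => ‖x‖ * (q x)⁻¹) θ
        (W (q θ • (θ : Euc (n + 1))))) ∂(surfaceMeasure (n + 1)) := by
  have h0 : ∀ x ∈ coneOver ω, 0 < ‖x‖ := fun x hx => norm_pos_iff.2 hx.1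
  have key := setIntegral_divergence_sublevel hω (h := fun x => ‖x‖ * (q x)⁻¹)
    (fun x hx => ((contDiffAt_norm ℝ hx.1).contDiffWithinAt).mul
      ((hq x hx).inv (hpos x hx).ne'))
    (fun x hx => mul_pos (h0 x hx) (inv_pos.2 (hpos x hx)))
    (fun x hx r hr => by
      rw [hhom x hx r hr, norm_smul, Real.norm_of_nonneg hr.le, mul_assoc]) hW hc hs
  have e : {x ∈ coneOver ω | ‖x‖ * (q x)⁻¹ < 1} = radialSubgraph ω q := by
    ext x
    refine and_congr_right fun hx => ?_
    rw [← div_eq_mul_inv, div_lt_one (hpos x hx)]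
  rw [e] at key
  have e2 : ∀ θ : USphere (n + 1), (‖(θ : Euc (n + 1))‖ * (q θ)⁻¹)⁻¹ = q θ := fun θ => by
    rw [θ.norm_coe, one_mul, inv_inv]
  simp_rw [e2] at key
  simp_rw [mul_left_comm (q _ ^ n)]
  exact key

/-- Upper bound for the perimeter of a radial graph, up to first order in `|∇q|² / q²` the exact
value. No condition at the boundary of the cone is needed: test fields have compact support in
it. -/
theorem weightedPerimeter_radialSubgraph_le (hω : IsOpen ω) {φ q : Euc (n + 1) → ℝ}
    (hφ : ContDiffOn ℝ 1 φ (coneOver ω)) (hφpos : ∀ x ∈ coneOver ω, 0 < φ x)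
    (hq : ContDiffOn ℝ 1 q (coneOver ω)) (hpos : ∀ x ∈ coneOver ω, 0 < q x)
    (hhom : ∀ x ∈ coneOver ω, ∀ r : ℝ, 0 < r → q (r • x) = q x) :
    weightedPerimeter φ (radialSubgraph ω q) (coneOver ω) ≤
      ∫⁻ θ in ω, ENNReal.ofReal (q θ ^ n * φ (q θ • (θ : Euc (n + 1))) *
        (1 + ‖gradient q θ‖ ^ 2 / (2 * q θ ^ 2))) ∂(surfaceMeasure (n + 1)) := by
  refine iSup₂_le fun v hv => ?_
  obtain ⟨hv1, hvc, hvs, hvn⟩ := hv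
  have hΩ := isOpen_coneOver hω
  have hsub := tsupport_smul_field_subset φ v
  obtain ⟨hint, heq⟩ := setIntegral_divergence_radialSubgraph hω hq hpos hhom
    (contDiff_smul_of_tsupport_subset hΩ hφ hv1 hvs) (hvc.mono' (subset_closure.trans hsub))
    (hsub.trans hvs)
  rw [heq]
  refine (ofReal_integral_le_lintegral hint).trans ?_
  refine setLIntegral_mono' hω.measurableSet fun θ hθ => ENNReal.ofReal_le_ofReal ?_
  have hθ' : (θ : Euc (n + 1)) ∈ coneOver ω := (coe_mem_coneOver θ).2 hθ
  have hqθ := hpos θ hθ'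
  have hφθ := hφpos _ (smul_mem_coneOver_of_mem hθ' hqθ)
  have h1 := fderiv_norm_div_le ((hq.contDiffAt (hΩ.mem_nhds hθ')).differentiableAt one_ne_zero)
    hqθ (hhom θ hθ') (hvn (q θ • (θ : Euc (n + 1))))
  rw [map_smul, smul_eq_mul, mul_left_comm (q θ), ← mul_assoc]
  gcongr

/-- The lower bound for the perimeter of a ball: test with the radial field `x / |x|`, cut off
near the boundary of the cone. -/
theorem le_weightedPerimeter_ball (hω : IsOpen ω) {φ : Euc (n + 1) → ℝ}
    (hφ : ContDiffOn ℝ 1 φ (coneOver ω)) (hφpos : ∀ x ∈ coneOver ω, 0 < φ x) {R : ℝ}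
    (hR : 0 < R) :
    ∫⁻ θ in ω, ENNReal.ofReal (R ^ n * φ (R • (θ : Euc (n + 1)))) ∂(surfaceMeasure (n + 1)) ≤
      weightedPerimeter φ (ball 0 R ∩ coneOver ω) (coneOver ω) := by
  have hΩ := isOpen_coneOver hω
  rw [ball_inter_coneOver]
  obtain ⟨K, hKc, hKω, hKU, hKm⟩ := hω.exists_iUnion_isClosed
  rw [← hKU, setLIntegral_iUnion_of_directed _ hKm.directed_le, hKU]
  refine iSup_le fun j => ?_
  -- with `ω` exhausted by compact sets `K j`, cut off by a function equal to one on `R • K j`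
  have hRK : IsCompact ((fun θ : USphere (n + 1) => R • (θ : Euc (n + 1))) '' K j) :=
    (hKc j).isCompact.image (by fun_prop)
  have hRKΩ : (fun θ : USphere (n + 1) => R • (θ : Euc (n + 1))) '' K j ⊆ coneOver ω := by
    rintro _ ⟨θ, hθ, rfl⟩
    exact (smul_mem_coneOver hR θ).2 (hKω j hθ)
  obtain ⟨T, hT, hRKT, hTΩ⟩ := exists_compact_between hRK hΩ hRKΩ
  obtain ⟨χ, hχ1, hχ0, hχI⟩ := exists_contMDiffMap_one_nhds_of_subset_interior (n := 1)
    𝓘(ℝ, Euc (n + 1)) hRK.isClosed hRKT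
  have hχd : ContDiff ℝ 1 χ := χ.contMDiff.contDiff
  let v : Euc (n + 1) → Euc (n + 1) := fun x => χ x • ‖x‖⁻¹ • x
  have hv0 : ∀ x ∉ T, v x = 0 := fun x hx => by simp only [v, hχ0 x hx, zero_smul]
  have hvs : tsupport v ⊆ T := closure_minimal (fun x hx => by
    by_contra h; exact hx (hv0 x h)) hT.isClosed
  have hvt : IsTestField (coneOver ω) v := by
    refine ⟨?_, HasCompactSupport.intro hT hv0, hvs.trans hTΩ, fun x => ?_⟩
    · rw [contDiff_iff_contDiffAt]
      intro x
      by_cases hx : x ∈ T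
      · have hx0 := (hTΩ hx).1
        exact hχd.contDiffAt.smul
          (((contDiffAt_norm ℝ hx0).inv (norm_ne_zero_iff.2 hx0)).smul contDiffAt_id)
      · refine (contDiffAt_const (c := (0 : Euc (n + 1)))).congr_of_eventuallyEq ?_
        filter_upwards [hT.isClosed.isOpen_compl.mem_nhds hx] with y hy using hv0 y hy
    · simp only [v]
      rw [norm_smul, norm_smul, norm_inv, norm_norm, Real.norm_of_nonneg (hχI x).1]
      exact mul_le_one₀ (hχI x).2 (by positivity) (inv_mul_le_one)
  refine le_trans ?_ (le_iSup₂ (f := fun (v : Euc (n + 1) → Euc (n + 1))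
    (_ : IsTestField (coneOver ω) v) => ENNReal.ofReal (∫ x in radialSubgraph ω fun _ => R,
      divergence (fun y => φ y • v y) x)) v hvt)
  obtain ⟨hv1, hvc, hvs', hvn⟩ := hvt
  have hsub := tsupport_smul_field_subset φ v
  obtain ⟨hint, heq⟩ := setIntegral_divergence_radialSubgraph hω (q := fun _ => R)
    contDiffOn_const (fun _ _ => hR) (fun _ _ _ _ => rfl)
    (contDiff_smul_of_tsupport_subset hΩ hφ hv1 hvs') (hvc.mono' (subset_closure.trans hsub))
    (hsub.trans hvs')
  rw [heq]
  have hval : ∀ θ : USphere (n + 1), R ^ n * (R * fderiv ℝ (fun x : Euc (n + 1) => ‖x‖ * R⁻¹) θ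
      (φ (R • (θ : Euc (n + 1))) • v (R • (θ : Euc (n + 1))))) =
      R ^ n * (φ (R • (θ : Euc (n + 1))) * χ (R • (θ : Euc (n + 1)))) := by
    intro θ
    have h1 := hasFDerivAt_norm_div (fun _ => R) θ (differentiableAt_const _) hR
    have h2 : gradient (fun _ : Euc (n + 1) => R) (θ : Euc (n + 1)) = 0 := by simp [gradient]
    rw [h1.fderiv, h2, smul_zero, sub_zero]
    simp only [v, norm_smul_sphere hR.le, inv_smul_smul₀ hR.ne']
    rw [innerSL_apply_apply, inner_smul_left, inner_smul_right, inner_smul_right,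
      real_inner_self_eq_norm_sq, θ.norm_coe]
    simp only [conj_trivial]
    field_simp
  simp_rw [hval] at hint ⊢
  rw [ofReal_integral_eq_lintegral_ofReal hint]
  · refine le_trans ?_ (lintegral_mono_set (hKω j))
    refine setLIntegral_mono' (hKc j).measurableSet fun θ hθ => ENNReal.ofReal_le_ofReal ?_
    have : χ (R • (θ : Euc (n + 1))) = 1 :=
      hχ1.self_of_nhdsSet _ (mem_image_of_mem _ hθ)
    rw [this, mul_one]
  · filter_upwards [ae_restrict_mem hω.measurableSet] with θ hθ
    have := hφpos _ ((smul_mem_coneOver hR θ).2 hθ)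
    have := (hχI (R • (θ : Euc (n + 1)))).1
    simp only [Pi.zero_apply]
    positivity

/-! ### The density and the mass along a ray -/

theorem smul_mem_closure_coneOver {θ : USphere (n + 1)} (hθ : θ ∈ ω) {r : ℝ} (hr : 0 ≤ r) :
    r • (θ : Euc (n + 1)) ∈ closure (coneOver ω) := by
  have h1 : r ∈ closure (Ioi (0 : ℝ)) := by rwa [closure_Ioi]
  have h2 : Continuous fun r : ℝ => r • (θ : Euc (n + 1)) := by fun_prop
  exact map_mem_closure (f := fun r : ℝ => r • (θ : Euc (n + 1))) h2 h1 fun s hs =>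
    (smul_mem_coneOver hs θ).2 hθ

/-- `φ` is bounded on bounded parts of the cone, as it is continuous up to the boundary. -/
theorem exists_bound_on_ray {φ : Euc (n + 1) → ℝ} (hφc : ContinuousOn φ (closure (coneOver ω)))
    (ρ : ℝ) : ∃ C, 0 ≤ C ∧ ∀ θ ∈ ω, ∀ r ∈ Icc 0 ρ, |φ (r • (θ : Euc (n + 1)))| ≤ C := by
  have hK : IsCompact (closure (coneOver ω) ∩ closedBall 0 ρ) :=
    (isCompact_closedBall _ _).inter_left isClosed_closure
  obtain ⟨C, hC⟩ := hK.exists_bound_of_continuousOn (hφc.mono inter_subset_left)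
  refine ⟨|C|, abs_nonneg _, fun θ hθ r hr => ?_⟩
  refine (hC _ ⟨smul_mem_closure_coneOver hθ hr.1, ?_⟩).trans (le_abs_self C)
  rw [mem_closedBall_zero_iff, norm_smul_sphere hr.1]
  exact hr.2

/-- The density `r ^ n φ(r θ)` of the weighted measure in polar coordinates. -/
noncomputable def radialDensity (φ : Euc (n + 1) → ℝ) (r : ℝ) (θ : USphere (n + 1)) : ℝ :=
  r ^ n * φ (r • (θ : Euc (n + 1)))

/-- The radial derivative of `radialDensity`. -/
noncomputable def radialDensityDeriv (φ : Euc (n + 1) → ℝ) (r : ℝ) (θ : USphere (n + 1)) : ℝ :=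
  n * r ^ (n - 1) * φ (r • (θ : Euc (n + 1))) +
    r ^ n * fderiv ℝ φ (r • (θ : Euc (n + 1))) θ

/-- The mass `∫₀ʳ sⁿ φ(s θ) ds` of the segment of length `r` in the direction `θ`. -/
noncomputable def radialMass (φ : Euc (n + 1) → ℝ) (r : ℝ) (θ : USphere (n + 1)) : ℝ :=
  ∫ s in (0 : ℝ)..r, radialDensity φ s θ

theorem continuousOn_radialDensity_ray {φ : Euc (n + 1) → ℝ}
    (hφc : ContinuousOn φ (closure (coneOver ω))) {θ : USphere (n + 1)} (hθ : θ ∈ ω) :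
    ContinuousOn (fun r => radialDensity φ r θ) (Ici 0) := by
  refine (continuous_pow n).continuousOn.mul (hφc.comp (by fun_prop) fun r hr => ?_)
  exact smul_mem_closure_coneOver hθ hr

theorem radialDensity_pos {φ : Euc (n + 1) → ℝ} (hφpos : ∀ x ∈ coneOver ω, 0 < φ x)
    {θ : USphere (n + 1)} (hθ : θ ∈ ω) {r : ℝ} (hr : 0 < r) : 0 < radialDensity φ r θ :=
  mul_pos (pow_pos hr n) (hφpos _ ((smul_mem_coneOver hr θ).2 hθ))

theorem continuousOn_radialDensity {φ : Euc (n + 1) → ℝ} (hφ : ContinuousOn φ (coneOver ω)) :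
    ContinuousOn (fun p : ℝ × USphere (n + 1) => radialDensity φ p.1 p.2) (Ioi 0 ×ˢ ω) := by
  refine (by fun_prop : ContinuousOn (fun p : ℝ × USphere (n + 1) => p.1 ^ n) _).mul
    (hφ.comp (by fun_prop) fun p hp => (smul_mem_coneOver hp.1 p.2).2 hp.2)

theorem continuousOn_radialDensityDeriv (hω : IsOpen ω) {φ : Euc (n + 1) → ℝ}
    (hφ : ContDiffOn ℝ 1 φ (coneOver ω)) :
    ContinuousOn (fun p : ℝ × USphere (n + 1) => radialDensityDeriv φ p.1 p.2) (Ioi 0 ×ˢ ω) := by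
  have hm : MapsTo (fun p : ℝ × USphere (n + 1) => p.1 • (p.2 : Euc (n + 1))) (Ioi 0 ×ˢ ω)
      (coneOver ω) := fun p hp => (smul_mem_coneOver hp.1 p.2).2 hp.2
  have hc : ContinuousOn (fun p : ℝ × USphere (n + 1) => p.1 • (p.2 : Euc (n + 1)))
    (Ioi 0 ×ˢ ω) := by fun_prop
  have h1 := hφ.continuousOn.comp hc hm
  have h2 := (hφ.continuousOn_fderiv_of_isOpen (isOpen_coneOver hω) le_rfl).comp hc hm
  have h3 : ContinuousOn (fun p : ℝ × USphere (n + 1) => (p.2 : Euc (n + 1))) (Ioi 0 ×ˢ ω) := by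
    fun_prop
  exact ((by fun_prop : ContinuousOn (fun p : ℝ × USphere (n + 1) => n * p.1 ^ (n - 1)) _).mul
    h1).add ((by fun_prop : ContinuousOn (fun p : ℝ × USphere (n + 1) => p.1 ^ n) _).mul
    (h2.clm_apply h3))

theorem hasDerivAt_radialDensity (hω : IsOpen ω) {φ : Euc (n + 1) → ℝ}
    (hφ : ContDiffOn ℝ 1 φ (coneOver ω)) {θ : USphere (n + 1)} (hθ : θ ∈ ω) {r : ℝ} (hr : 0 < r) :
    HasDerivAt (fun r => radialDensity φ r θ) (radialDensityDeriv φ r θ) r := by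
  have h1 := (hφ.contDiffAt ((isOpen_coneOver hω).mem_nhds
    ((smul_mem_coneOver hr θ).2 hθ))).differentiableAt one_ne_zero
  have h2 : HasDerivAt (fun r : ℝ => r • (θ : Euc (n + 1))) (θ : Euc (n + 1)) r := by
    simpa using (hasDerivAt_id r).smul_const (θ : Euc (n + 1))
  exact (hasDerivAt_pow n r).mul (h1.hasFDerivAt.comp_hasDerivAt r h2)

theorem hasDerivAt_radialMass {φ : Euc (n + 1) → ℝ}
    (hφc : ContinuousOn φ (closure (coneOver ω))) {θ : USphere (n + 1)} (hθ : θ ∈ ω) {r : ℝ}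
    (hr : 0 < r) : HasDerivAt (fun r => radialMass φ r θ) (radialDensity φ r θ) r := by
  have hc := continuousOn_radialDensity_ray hφc hθ
  refine intervalIntegral.integral_hasDerivAt_right ?_ ?_ (hc.continuousAt (Ici_mem_nhds hr))
  · refine ContinuousOn.intervalIntegrable (hc.mono ?_)
    rw [uIcc_of_le hr.le]
    exact Icc_subset_Ici_self
  · exact (hc.mono Ioi_subset_Ici_self).stronglyMeasurableAtFilter isOpen_Ioi r hr

theorem lintegral_radialDensity {φ : Euc (n + 1) → ℝ}
    (hφc : ContinuousOn φ (closure (coneOver ω))) (hφpos : ∀ x ∈ coneOver ω, 0 < φ x)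
    {θ : USphere (n + 1)} (hθ : θ ∈ ω) {r : ℝ} (hr : 0 < r) :
    ∫⁻ s in Ioo 0 r, ENNReal.ofReal (radialDensity φ s θ) =
      ENNReal.ofReal (radialMass φ r θ) := by
  have hc := continuousOn_radialDensity_ray hφc hθ
  rw [radialMass, intervalIntegral.integral_of_le hr.le, integral_Ioc_eq_integral_Ioo,
    ofReal_integral_eq_lintegral_ofReal]
  · exact ((hc.mono Icc_subset_Ici_self).integrableOn_Icc).mono_set Ioo_subset_Icc_self
  · filter_upwards [ae_restrict_mem measurableSet_Ioo] with s hs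
    exact (radialDensity_pos hφpos hθ hs.1).le

theorem radialMass_nonneg {φ : Euc (n + 1) → ℝ} (hφpos : ∀ x ∈ coneOver ω, 0 < φ x)
    {θ : USphere (n + 1)} (hθ : θ ∈ ω) {r : ℝ} (hr : 0 < r) : 0 ≤ radialMass φ r θ := by
  rw [radialMass, intervalIntegral.integral_of_le hr.le]
  exact setIntegral_nonneg measurableSet_Ioc fun s hs => (radialDensity_pos hφpos hθ hs.1).le

theorem exists_bound_radialDensity {φ : Euc (n + 1) → ℝ}
    (hφc : ContinuousOn φ (closure (coneOver ω))) {ρ : ℝ} (hρ : 0 ≤ ρ) :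
    ∃ C, 0 ≤ C ∧ ∀ θ ∈ ω, ∀ r ∈ Icc 0 ρ, |radialDensity φ r θ| ≤ C := by
  obtain ⟨C, hC0, hC⟩ := exists_bound_on_ray hφc ρ
  refine ⟨ρ ^ n * C, by positivity, fun θ hθ r hr => ?_⟩
  rw [radialDensity, abs_mul, abs_of_nonneg (pow_nonneg hr.1 n)]
  have := hr.1
  gcongr
  · exact hr.2
  · exact hC θ hθ r hr

/-- The mass below a continuous radial graph depends continuously on the direction; rescaling the
segment to `[0, 1]` makes the domain of integration constant. -/
theorem continuousOn_radialMass_comp {φ : Euc (n + 1) → ℝ}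
    (hφc : ContinuousOn φ (closure (coneOver ω))) {q : USphere (n + 1) → ℝ}
    (hq : ContinuousOn q ω) {ρ : ℝ} (hq0 : ∀ θ ∈ ω, 0 < q θ) (hqρ : ∀ θ ∈ ω, q θ ≤ ρ) :
    ContinuousOn (fun θ => radialMass φ (q θ) θ) ω := by
  have h1 : ∀ r (θ : USphere (n + 1)), radialMass φ r θ =
      r * ∫ τ in (0 : ℝ)..1, radialDensity φ (r * τ) θ := by
    intro r θ
    have := intervalIntegral.smul_integral_comp_mul_left (a := 0) (b := 1)
      (fun s => radialDensity φ s θ) r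
    rw [smul_eq_mul, mul_zero, mul_one] at this
    rw [this, radialMass]
  simp_rw [h1]
  refine hq.mul fun θ₀ hθ₀ => ?_
  have hρ : 0 ≤ ρ := (hq0 θ₀ hθ₀).le.trans (hqρ θ₀ hθ₀)
  obtain ⟨C, hC0, hC⟩ := exists_bound_radialDensity hφc hρ
  refine intervalIntegral.continuousWithinAt_of_dominated_interval (bound := fun _ => C) ?_ ?_
    intervalIntegrable_const ?_
  · filter_upwards [self_mem_nhdsWithin] with θ hθ
    rw [uIoc_of_le zero_le_one]
    refine ContinuousOn.aestronglyMeasurable ?_ measurableSet_Ioc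
    refine (continuousOn_radialDensity_ray hφc hθ).comp (by fun_prop) fun τ hτ => ?_
    exact mul_nonneg (hq0 θ hθ).le hτ.1.le
  · filter_upwards [self_mem_nhdsWithin] with θ hθ
    refine Eventually.of_forall fun τ hτ => ?_
    rw [uIoc_of_le zero_le_one] at hτ
    refine hC θ hθ _ ⟨mul_nonneg (hq0 θ hθ).le hτ.1.le, ?_⟩
    exact (mul_le_of_le_one_right (hq0 θ hθ).le hτ.2).trans (hqρ θ hθ)
  · refine Eventually.of_forall fun τ hτ => ?_
    rw [uIoc_of_le zero_le_one] at hτ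
    have h2 : ContinuousWithinAt (fun θ : USphere (n + 1) => (q θ * τ, θ)) ω θ₀ :=
      ((hq θ₀ hθ₀).mul continuousWithinAt_const).prodMk continuousWithinAt_id
    have h3 := continuousOn_radialDensity (hφc.mono subset_closure) (q θ₀ * τ, θ₀)
      ⟨mul_pos (hq0 θ₀ hθ₀) hτ.1, hθ₀⟩
    exact ContinuousWithinAt.comp (f := fun θ => (q θ * τ, θ)) (x := θ₀) h3 h2
      fun θ hθ => ⟨mul_pos (hq0 θ hθ) hτ.1, hθ⟩

theorem abs_radialMass_le {φ : Euc (n + 1) → ℝ} {ρ C : ℝ}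
    (hC : ∀ θ ∈ ω, ∀ r ∈ Icc 0 ρ, |radialDensity φ r θ| ≤ C) {θ : USphere (n + 1)} (hθ : θ ∈ ω)
    (hC0 : 0 ≤ C) {r : ℝ} (hr0 : 0 ≤ r) (hr : r ≤ ρ) : |radialMass φ r θ| ≤ C * ρ := by
  have h1 := intervalIntegral.norm_integral_le_of_norm_le_const (a := 0) (b := r) (C := C)
    (f := fun s => radialDensity φ s θ) fun s hs => by
      rw [uIoc_of_le hr0] at hs
      exact hC θ hθ s ⟨hs.1.le, hs.2.trans hr⟩
  rw [sub_zero, abs_of_nonneg hr0] at h1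
  exact h1.trans (by gcongr)

theorem integrableOn_radialMass_comp (hω : IsOpen ω) {φ : Euc (n + 1) → ℝ}
    (hφc : ContinuousOn φ (closure (coneOver ω))) {q : USphere (n + 1) → ℝ}
    (hq : ContinuousOn q ω) {ρ : ℝ} (hρ : 0 ≤ ρ) (hq0 : ∀ θ ∈ ω, 0 < q θ)
    (hqρ : ∀ θ ∈ ω, q θ ≤ ρ) :
    IntegrableOn (fun θ => radialMass φ (q θ) θ) ω (surfaceMeasure (n + 1)) := by
  obtain ⟨C, hC0, hC⟩ := exists_bound_radialDensity hφc hρ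
  refine Integrable.of_bound ((continuousOn_radialMass_comp hφc hq hq0 hqρ).aestronglyMeasurable
    hω.measurableSet) (C * ρ) ?_
  filter_upwards [ae_restrict_mem hω.measurableSet] with θ hθ
  exact abs_radialMass_le hC hθ hC0 (hq0 θ hθ).le (hqρ θ hθ)

theorem integrableOn_radialDensity_comp (hω : IsOpen ω) {φ : Euc (n + 1) → ℝ}
    (hφc : ContinuousOn φ (closure (coneOver ω))) {q : USphere (n + 1) → ℝ}
    (hq : ContinuousOn q ω) {ρ : ℝ} (hρ : 0 ≤ ρ) (hq0 : ∀ θ ∈ ω, 0 < q θ)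
    (hqρ : ∀ θ ∈ ω, q θ ≤ ρ) :
    IntegrableOn (fun θ => radialDensity φ (q θ) θ) ω (surfaceMeasure (n + 1)) := by
  obtain ⟨C, hC0, hC⟩ := exists_bound_radialDensity hφc hρ
  have h1 : ContinuousOn (fun θ => radialDensity φ (q θ) θ) ω :=
    (continuousOn_radialDensity (hφc.mono subset_closure)).comp (hq.prodMk continuousOn_id)
      fun θ hθ => ⟨hq0 θ hθ, hθ⟩
  refine Integrable.of_bound (h1.aestronglyMeasurable hω.measurableSet) C ?_
  filter_upwards [ae_restrict_mem hω.measurableSet] with θ hθ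
  exact hC θ hθ _ ⟨(hq0 θ hθ).le, hqρ θ hθ⟩

theorem weightedMeasure_radialSubgraph_eq_ofReal (hω : IsOpen ω) {φ q : Euc (n + 1) → ℝ}
    (hφc : ContinuousOn φ (closure (coneOver ω))) (hφpos : ∀ x ∈ coneOver ω, 0 < φ x)
    (hq : ContinuousOn q (coneOver ω)) (hqpos : ∀ x ∈ coneOver ω, 0 < q x)
    (hqhom : ∀ x ∈ coneOver ω, ∀ r : ℝ, 0 < r → q (r • x) = q x) {ρ : ℝ} (hρ : 0 ≤ ρ)
    (hqρ : ∀ x ∈ coneOver ω, q x ≤ ρ) :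
    weightedMeasure φ (coneOver ω) (radialSubgraph ω q) =
      ENNReal.ofReal (∫ θ in ω, radialMass φ (q θ) θ ∂(surfaceMeasure (n + 1))) := by
  have hm : MapsTo (fun θ : USphere (n + 1) => (θ : Euc (n + 1))) ω (coneOver ω) :=
    fun θ hθ => (coe_mem_coneOver θ).2 hθ
  rw [weightedMeasure_radialSubgraph hω (hφc.mono subset_closure) hq hqhom,
    ofReal_integral_eq_lintegral_ofReal
      (integrableOn_radialMass_comp (q := fun θ => q θ) hω hφc (hq.comp (by fun_prop) hm) hρ
        (fun θ hθ => hqpos _ (hm hθ)) fun θ hθ => hqρ _ (hm hθ))]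
  · exact setLIntegral_congr_fun hω.measurableSet fun θ hθ =>
      lintegral_radialDensity hφc hφpos hθ (hqpos _ (hm hθ))
  · filter_upwards [ae_restrict_mem hω.measurableSet] with θ hθ
    exact radialMass_nonneg hφpos hθ (hqpos _ (hm hθ))

/-! ### The isoperimetric inequality for radial graphs -/

/-- The isoperimetric inequality for radial graphs, when the balls centred at the origin are
isoperimetric. -/
theorem lintegral_radialDensity_le_of_mass_eq (hω : IsOpen ω) {φ q : Euc (n + 1) → ℝ}
    (hφ : ContDiffOn ℝ 1 φ (coneOver ω)) (hφc : ContinuousOn φ (closure (coneOver ω)))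
    (hφpos : ∀ x ∈ coneOver ω, 0 < φ x) {R : ℝ} (hR : 0 < R)
    (hiso : isoperimetricProfile φ (coneOver ω)
          (weightedMeasure φ (coneOver ω) (ball 0 R ∩ coneOver ω)) =
        weightedPerimeter φ (ball 0 R ∩ coneOver ω) (coneOver ω))
    (hq : ContDiffOn ℝ 1 q (coneOver ω)) (hqpos : ∀ x ∈ coneOver ω, 0 < q x)
    (hqhom : ∀ x ∈ coneOver ω, ∀ r : ℝ, 0 < r → q (r • x) = q x) {ρ : ℝ} (hρ : 0 ≤ ρ)
    (hqρ : ∀ x ∈ coneOver ω, q x ≤ ρ)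
    (hmass : ∫ θ in ω, radialMass φ (q θ) θ ∂(surfaceMeasure (n + 1)) =
      ∫ θ in ω, radialMass φ R θ ∂(surfaceMeasure (n + 1))) :
    ∫⁻ θ in ω, ENNReal.ofReal (radialDensity φ R θ) ∂(surfaceMeasure (n + 1)) ≤
      ∫⁻ θ in ω, ENNReal.ofReal (radialDensity φ (q θ) θ *
        (1 + ‖gradient q θ‖ ^ 2 / (2 * q θ ^ 2))) ∂(surfaceMeasure (n + 1)) := by
  refine (le_weightedPerimeter_ball hω hφ hφpos hR).trans ?_
  rw [← hiso]
  refine le_trans ?_ (weightedPerimeter_radialSubgraph_le hω hφ hφpos hq hqpos hqhom)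
  refine (iInf_le_of_le (radialSubgraph ω q) (iInf_le_of_le
    (measurableSet_radialSubgraph hω hq.continuousOn) (iInf_le_of_le
    (radialSubgraph_subset q) (iInf_le_of_le ?_ le_rfl))))
  rw [ball_inter_coneOver,
    weightedMeasure_radialSubgraph_eq_ofReal hω hφc hφpos hq.continuousOn hqpos hqhom hρ hqρ,
    weightedMeasure_radialSubgraph_eq_ofReal hω hφc hφpos continuousOn_const (fun _ _ => hR)
      (fun _ _ _ _ => rfl) hR.le (fun _ _ => le_rfl), hmass]

/-! ### The first variation and the product structure -/

/-- A Lagrange multiplier rule for separated variables: if, subject to `v₁(t) + v₂(s)` being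
constant, the perimeter `p₁(t) + p₂(s)` is minimal at the origin up to an error of second order,
then `p₁' / v₁' = p₂' / v₂'`. The constraint is solved for `s` by the inverse function theorem. -/
theorem deriv_mul_eq_of_constrained_min {p₁ p₂ v₁ v₂ : ℝ → ℝ} {p₁' p₂' v₁' v₂' C P δ : ℝ}
    (hp₁ : HasDerivAt p₁ p₁' 0) (hp₂ : HasDerivAt p₂ p₂' 0) (hv₁ : HasDerivAt v₁ v₁' 0)
    (hv₂ : HasStrictDerivAt v₂ v₂' 0) (hv₂' : v₂' ≠ 0) (hδ : 0 < δ)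
    (hmin : ∀ t s, |t| < δ → |s| < δ → v₁ t - v₁ 0 + (v₂ s - v₂ 0) = 0 →
      P ≤ (1 + C * (t ^ 2 + s ^ 2)) * (P + (p₁ t - p₁ 0) + (p₂ s - p₂ 0))) :
    p₁' * v₂' = p₂' * v₁' := by
  set S := HasStrictDerivAt.localInverse v₂ v₂' 0 hv₂ hv₂' with hS
  have hS1 : HasDerivAt S v₂'⁻¹ (v₂ 0) := (hv₂.to_localInverse hv₂').hasDerivAt
  have hS2 : ∀ᶠ y in 𝓝 (v₂ 0), v₂ (S y) = y :=
    (hv₂.hasStrictFDerivAt_equiv hv₂').eventually_right_inverse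
  have hS0 : S (v₂ 0) = 0 := (hv₂.hasStrictFDerivAt_equiv hv₂').localInverse_apply_image
  -- `s t` compensates the change of `v₁`
  let s : ℝ → ℝ := fun t => S (v₂ 0 + (v₁ 0 - v₁ t))
  have e0 : v₂ 0 + (v₁ 0 - v₁ 0) = v₂ 0 := by ring
  have hs0 : s 0 = 0 := by simp only [s, e0, hS0]
  have hin : HasDerivAt (fun t => v₂ 0 + (v₁ 0 - v₁ t)) (-v₁') 0 := (hv₁.const_sub _).const_add _
  have hs : HasDerivAt s (v₂'⁻¹ * -v₁') 0 := by
    have : HasDerivAt S v₂'⁻¹ (v₂ 0 + (v₁ 0 - v₁ 0)) := by rwa [e0]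
    exact this.comp (0 : ℝ) hin
  have hp₂s : HasDerivAt (fun t => p₂ (s t)) (p₂' * (v₂'⁻¹ * -v₁')) 0 := by
    have : HasDerivAt p₂ p₂' (s 0) := by rwa [hs0]
    exact this.comp (0 : ℝ) hs
  have hE := (((((hasDerivAt_id (0 : ℝ)).pow 2).add (hs.pow 2)).const_mul C).const_add 1).mul
    (((hp₁.sub_const (p₁ 0)).const_add P).add (hp₂s.sub_const (p₂ 0)))
  have hloc : IsLocalMin ((fun t => 1 + C * ((id ^ 2 + s ^ 2 : ℝ → ℝ) t)) *
      ((fun t => P + (p₁ t - p₁ 0)) + fun t => p₂ (s t) - p₂ 0)) 0 := by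
    have h1 : ∀ᶠ t in 𝓝 (0 : ℝ), |t| < δ := by
      exact (isOpen_lt continuous_abs continuous_const).mem_nhds (by simpa using hδ)
    have h2 : ∀ᶠ t in 𝓝 (0 : ℝ), |s t| < δ := by
      have := hs.continuousAt.tendsto
      rw [hs0] at this
      exact this.eventually h1
    have h3 : ∀ᶠ t in 𝓝 (0 : ℝ), v₂ (s t) = v₂ 0 + (v₁ 0 - v₁ t) := by
      have := hin.continuousAt.tendsto
      rw [e0] at this
      exact this.eventually hS2
    filter_upwards [h1, h2, h3] with t ht1 ht2 ht3
    have := hmin t (s t) ht1 ht2 (by rw [ht3]; ring)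
    simpa [hs0, add_assoc] using this
  have h0 := hloc.hasDerivAt_eq_zero hE
  simp [hs0] at h0
  field_simp at h0
  linarith

/-- Differentiation under the integral sign along the radial perturbation `R + t u`. The bound
`|t| < R / 2` keeps the radii in the compact interval `[R / 2, 3 R / 2]`. -/
theorem hasDerivAt_setIntegral_radial {K : Set (USphere (n + 1))} (hK : IsClosed K) {R : ℝ}
    {u : USphere (n + 1) → ℝ} (hu : ContinuousOn u K)
    (hu1 : ∀ θ ∈ K, |u θ| ≤ 1) {g g' : ℝ → USphere (n + 1) → ℝ}
    (hgc : ∀ t, |t| < R / 2 → ContinuousOn (fun θ => g (R + t * u θ) θ) K)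
    (hg'c : ContinuousOn (fun p : ℝ × USphere (n + 1) => g' p.1 p.2) (Ioi 0 ×ˢ K))
    (hd : ∀ θ ∈ K, ∀ r, 0 < r → HasDerivAt (fun r => g r θ) (g' r θ) r) {t₀ : ℝ}
    (ht₀ : |t₀| < R / 2) :
    HasDerivAt (fun t => ∫ θ in K, g (R + t * u θ) θ ∂(surfaceMeasure (n + 1)))
      (∫ θ in K, g' (R + t₀ * u θ) θ * u θ ∂(surfaceMeasure (n + 1))) t₀ := by
  have hR : 0 < R := by have := abs_nonneg t₀; linarith
  have hrange : ∀ t, |t| < R / 2 → ∀ θ ∈ K, R + t * u θ ∈ Icc (R / 2) (3 * R / 2) := by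
    intro t ht θ hθ
    have h1 : |t * u θ| ≤ R / 2 := by
      rw [abs_mul]
      exact (mul_le_of_le_one_right (abs_nonneg t) (hu1 θ hθ)).trans ht.le
    have := abs_le.1 h1
    constructor <;> linarith [this.1, this.2]
  have hcomp : IsCompact (Icc (R / 2) (3 * R / 2) ×ˢ K) := isCompact_Icc.prod hK.isCompact
  have hsub : Icc (R / 2) (3 * R / 2) ×ˢ K ⊆ Ioi 0 ×ˢ K :=
    prod_mono (fun x hx => lt_of_lt_of_le (by positivity) hx.1) subset_rfl
  obtain ⟨C, hC⟩ := hcomp.exists_bound_of_continuousOn (hg'c.mono hsub)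
  have hopen : {t : ℝ | |t| < R / 2} ∈ 𝓝 t₀ :=
    (isOpen_lt continuous_abs continuous_const).mem_nhds ht₀
  refine (hasDerivAt_integral_of_dominated_loc_of_deriv_le (bound := fun _ => C) hopen
    (F := fun t θ => g (R + t * u θ) θ) (F' := fun t θ => g' (R + t * u θ) θ * u θ)
    ?_ ?_ ?_ ?_ (integrable_const _) ?_).2
  · filter_upwards [hopen] with t ht
    exact (hgc t ht).aestronglyMeasurable hK.measurableSet
  · exact (hgc t₀ ht₀).integrableOn_compact hK.isCompact
  · refine ContinuousOn.aestronglyMeasurable ?_ hK.measurableSet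
    refine ContinuousOn.mul ?_ hu
    refine hg'c.comp ((continuousOn_const.add (continuousOn_const.mul hu)).prodMk continuousOn_id)
      fun θ hθ => hsub ⟨hrange t₀ ht₀ θ hθ, hθ⟩
  · filter_upwards [ae_restrict_mem hK.measurableSet] with θ hθ t ht
    rw [norm_mul]
    exact (mul_le_of_le_one_right (norm_nonneg _) (hu1 θ hθ)).trans
      (hC (_, θ) ⟨hrange t ht θ hθ, hθ⟩)
  · filter_upwards [ae_restrict_mem hK.measurableSet] with θ hθ t ht
    have h1 : HasDerivAt (fun t : ℝ => R + t * u θ) (u θ) t := by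
      simpa using ((hasDerivAt_id t).mul_const (u θ)).const_add R
    exact (hd θ hθ _ (hsub (mk_mem_prod (hrange t ht θ hθ) hθ)).1).comp t h1

/-- For perturbations with disjoint supports the changes of an integral add up. Only the supports
`K₁`, `K₂` occur in the difference terms, so that nothing is needed near the boundary of `ω`. -/
theorem setIntegral_perturb_split (hω : IsOpen ω) {K₁ K₂ : Set (USphere (n + 1))}
    (hK₁ : IsClosed K₁) (hK₂ : IsClosed K₂) (hK₁ω : K₁ ⊆ ω) (hK₂ω : K₂ ⊆ ω)
    (hdisj : Disjoint K₁ K₂) {u₁ u₂ : USphere (n + 1) → ℝ} (hu₁ : ∀ θ ∈ ω, θ ∉ K₁ → u₁ θ = 0)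
    (hu₂ : ∀ θ ∈ ω, θ ∉ K₂ → u₂ θ = 0) {g : ℝ → USphere (n + 1) → ℝ} {R t s : ℝ}
    (hgR : IntegrableOn (fun θ => g R θ) ω (surfaceMeasure (n + 1)))
    (hg₁ : IntegrableOn (fun θ => g (R + t * u₁ θ) θ) ω (surfaceMeasure (n + 1)))
    (hg₂ : IntegrableOn (fun θ => g (R + s * u₂ θ) θ) ω (surfaceMeasure (n + 1))) :
    ∫ θ in ω, g (R + t * u₁ θ + s * u₂ θ) θ ∂(surfaceMeasure (n + 1)) =
      ∫ θ in ω, g R θ ∂(surfaceMeasure (n + 1)) +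
      (∫ θ in K₁, g (R + t * u₁ θ) θ ∂(surfaceMeasure (n + 1)) -
        ∫ θ in K₁, g R θ ∂(surfaceMeasure (n + 1))) +
      (∫ θ in K₂, g (R + s * u₂ θ) θ ∂(surfaceMeasure (n + 1)) -
        ∫ θ in K₂, g R θ ∂(surfaceMeasure (n + 1))) := by
  have hpt : ∀ θ ∈ ω, g (R + t * u₁ θ + s * u₂ θ) θ = g R θ +
      K₁.indicator (fun θ => g (R + t * u₁ θ) θ - g R θ) θ +
      K₂.indicator (fun θ => g (R + s * u₂ θ) θ - g R θ) θ := by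
    intro θ hθ
    by_cases h1 : θ ∈ K₁
    · have h2 : θ ∉ K₂ := disjoint_left.1 hdisj h1
      rw [indicator_of_mem h1, indicator_of_notMem h2, hu₂ θ hθ h2]
      simp
    · rw [indicator_of_notMem h1, hu₁ θ hθ h1]
      by_cases h2 : θ ∈ K₂
      · rw [indicator_of_mem h2]
        simp
      · rw [indicator_of_notMem h2, hu₂ θ hθ h2]
        simp
  have hi₁ : IntegrableOn (K₁.indicator fun θ => g (R + t * u₁ θ) θ - g R θ) ω
      (surfaceMeasure (n + 1)) := (hg₁.sub hgR).indicator hK₁.measurableSet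
  have hi₂ : IntegrableOn (K₂.indicator fun θ => g (R + s * u₂ θ) θ - g R θ) ω
      (surfaceMeasure (n + 1)) := (hg₂.sub hgR).indicator hK₂.measurableSet
  have hi₃ : IntegrableOn (fun θ => g R θ + K₁.indicator (fun θ => g (R + t * u₁ θ) θ - g R θ) θ) ω
      (surfaceMeasure (n + 1)) := hgR.add hi₁
  rw [setIntegral_congr_fun hω.measurableSet hpt, integral_add hi₃ hi₂,
    integral_add hgR hi₁, setIntegral_indicator hK₁.measurableSet,
    setIntegral_indicator hK₂.measurableSet, inter_eq_right.2 hK₁ω, inter_eq_right.2 hK₂ω,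
    integral_sub (hg₁.mono_set hK₁ω) (hgR.mono_set hK₁ω),
    integral_sub (hg₂.mono_set hK₂ω) (hgR.mono_set hK₂ω)]

theorem norm_gradient_eq_norm_fderiv {N : ℕ} (f : Euc N → ℝ) (x : Euc N) :
    ‖gradient f x‖ = ‖fderiv ℝ f x‖ := by
  rw [gradient, LinearIsometryEquiv.norm_map]

/-- A bump function on the sphere, extended to be constant along rays: it is positive on `O`,
vanishes off `K`, and has a bounded gradient on the sphere. -/
theorem exists_angular_bump {V : Set (USphere (n + 1))} (hV : IsOpen V) {θ₀ : USphere (n + 1)}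
    (hθ₀ : θ₀ ∈ V) :
    ∃ (K O : Set (USphere (n + 1))) (U : Euc (n + 1) → ℝ) (C : ℝ),
      IsClosed K ∧ K ⊆ V ∧ IsOpen O ∧ θ₀ ∈ O ∧ O ⊆ K ∧ ContDiffOn ℝ 1 U {0}ᶜ ∧
      (∀ x, ∀ r : ℝ, 0 < r → U (r • x) = U x) ∧ (∀ x, U x ∈ Icc (0 : ℝ) 1) ∧
      (∀ θ : USphere (n + 1), θ ∉ K → U θ = 0) ∧ (∀ θ ∈ O, 0 < U (θ : Euc (n + 1))) ∧
      (∀ θ : USphere (n + 1), ‖fderiv ℝ U θ‖ ≤ C) := by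
  obtain ⟨ε, hε, hεV⟩ := Metric.isOpen_iff.1 hV θ₀ hθ₀
  let b : ContDiffBump (θ₀ : Euc (n + 1)) := ⟨ε / 4, ε / 2, by positivity, by linarith⟩
  have hsm : ContDiffOn ℝ 1 (fun x : Euc (n + 1) => b (‖x‖⁻¹ • x)) {0}ᶜ := by
    intro x hx
    have hx0 : x ≠ 0 := hx
    refine ContDiffAt.contDiffWithinAt ?_
    exact (b.contDiff (n := 1)).contDiffAt.comp x
      (((contDiffAt_norm ℝ hx0).inv (norm_ne_zero_iff.2 hx0)).smul contDiffAt_id)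
  have hval : ∀ θ : USphere (n + 1), ‖(θ : Euc (n + 1))‖⁻¹ • (θ : Euc (n + 1)) = θ := fun θ => by
    rw [θ.norm_coe, inv_one, one_smul]
  have hfc : ContinuousOn (fderiv ℝ fun x : Euc (n + 1) => b (‖x‖⁻¹ • x)) (sphere 0 1) :=
    (hsm.continuousOn_fderiv_of_isOpen isOpen_compl_singleton le_rfl).mono fun x hx =>
      USphere.coe_ne_zero ⟨x, hx⟩
  obtain ⟨C, hC⟩ := (isCompact_sphere (0 : Euc (n + 1)) 1).exists_bound_of_continuousOn hfc
  refine ⟨closedBall θ₀ (ε / 2), ball θ₀ (ε / 2), fun x => b (‖x‖⁻¹ • x), C, isClosed_closedBall,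
    (closedBall_subset_ball (by linarith)).trans hεV, isOpen_ball,
    mem_ball_self (by positivity), ball_subset_closedBall, hsm, ?_, fun x => ⟨b.nonneg, b.le_one⟩,
    ?_, ?_, fun θ => hC θ θ.2⟩
  · intro x r hr
    simp only [norm_smul, Real.norm_of_nonneg hr.le, mul_inv, smul_smul]
    rw [mul_right_comm, inv_mul_cancel₀ hr.ne', one_mul]
  · intro θ hθ
    simp only [hval]
    exact b.zero_of_le_dist (le_of_lt (not_le.1 hθ))
  · intro θ hθ
    simp only [hval]
    exact b.pos_of_mem_ball hθ

theorem setIntegral_pos_of_continuousOn {K O : Set (USphere (n + 1))} (hK : IsClosed K)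
    (hO : IsOpen O) (hne : O.Nonempty) (hOK : O ⊆ K) {g : USphere (n + 1) → ℝ}
    (hg : ContinuousOn g K) (hg0 : ∀ θ ∈ K, 0 ≤ g θ) (hgpos : ∀ θ ∈ O, 0 < g θ) :
    0 < ∫ θ in K, g θ ∂(surfaceMeasure (n + 1)) := by
  rw [setIntegral_pos_iff_support_of_nonneg_ae]
  · refine (hO.measure_pos _ hne).trans_le (measure_mono fun θ hθ => ⟨(hgpos θ hθ).ne', hOK hθ⟩)
  · filter_upwards [ae_restrict_mem hK.measurableSet] with θ hθ using hg0 θ hθ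
  · exact hg.integrableOn_compact hK.isCompact

/-- The first variation: the variation `R + t U₁ + s U₂` of the sphere of radius `R` moves mass
between two directions at which the logarithmic radial derivative of the density differs, and would
lower the perimeter. -/
theorem not_radialDensityDeriv_lt (hω : IsOpen ω) {φ : Euc (n + 1) → ℝ}
    (hφ : ContDiffOn ℝ 1 φ (coneOver ω)) (hφc : ContinuousOn φ (closure (coneOver ω)))
    (hφpos : ∀ x ∈ coneOver ω, 0 < φ x) {R : ℝ} (hR : 0 < R)
    (hiso : isoperimetricProfile φ (coneOver ω)
          (weightedMeasure φ (coneOver ω) (ball 0 R ∩ coneOver ω)) =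
        weightedPerimeter φ (ball 0 R ∩ coneOver ω) (coneOver ω))
    {θ₁ θ₂ : USphere (n + 1)} (hθ₁ : θ₁ ∈ ω) (hθ₂ : θ₂ ∈ ω) {c : ℝ}
    (h₁ : radialDensityDeriv φ R θ₁ < c * radialDensity φ R θ₁) :
    ¬ c * radialDensity φ R θ₂ < radialDensityDeriv φ R θ₂ := by
  intro h₂
  have hf := continuousOn_radialDensity (hφc.mono subset_closure)
  have hf' := continuousOn_radialDensityDeriv hω hφ
  have hslice : ContinuousOn (fun θ : USphere (n + 1) => (R, θ)) ω := by fun_prop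
  have hmR : MapsTo (fun θ : USphere (n + 1) => (R, θ)) ω (Ioi 0 ×ˢ ω) := fun θ hθ => ⟨hR, hθ⟩
  have hfR : ContinuousOn (fun θ => radialDensity φ R θ) ω := hf.comp hslice hmR
  have hfR' : ContinuousOn (fun θ => radialDensityDeriv φ R θ) ω := hf'.comp hslice hmR
  have hV₁ : IsOpen (ω ∩ (fun θ => radialDensityDeriv φ R θ - c * radialDensity φ R θ) ⁻¹' Iio 0) :=
    (hfR'.sub (continuousOn_const.mul hfR)).isOpen_inter_preimage hω isOpen_Iio
  have hV₂ : IsOpen (ω ∩ (fun θ => radialDensityDeriv φ R θ - c * radialDensity φ R θ) ⁻¹' Ioi 0) :=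
    (hfR'.sub (continuousOn_const.mul hfR)).isOpen_inter_preimage hω isOpen_Ioi
  obtain ⟨K₁, O₁, U₁, C₁, hK₁, hKV₁, hO₁, hθO₁, hOK₁, hU₁, hhom₁, hI₁, hz₁, hp₁, hC₁⟩ :=
    exists_angular_bump hV₁ (θ₀ := θ₁) ⟨hθ₁, sub_neg.2 h₁⟩
  obtain ⟨K₂, O₂, U₂, C₂, hK₂, hKV₂, hO₂, hθO₂, hOK₂, hU₂, hhom₂, hI₂, hz₂, hp₂, hC₂⟩ :=
    exists_angular_bump hV₂ (θ₀ := θ₂) ⟨hθ₂, sub_pos.2 h₂⟩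
  have hK₁ω : K₁ ⊆ ω := fun θ h => (hKV₁ h).1
  have hK₂ω : K₂ ⊆ ω := fun θ h => (hKV₂ h).1
  have hdisj : Disjoint K₁ K₂ := disjoint_left.2 fun θ h1 h2 => by
    have a : radialDensityDeriv φ R θ - c * radialDensity φ R θ < 0 := (hKV₁ h1).2
    have b : 0 < radialDensityDeriv φ R θ - c * radialDensity φ R θ := (hKV₂ h2).2
    exact lt_asymm a b
  have hcoe : Continuous fun θ : USphere (n + 1) => (θ : Euc (n + 1)) := continuous_subtype_val
  have hu₁ : Continuous fun θ : USphere (n + 1) => U₁ θ :=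
    hU₁.continuousOn.comp_continuous hcoe fun θ => θ.coe_ne_zero
  have hu₂ : Continuous fun θ : USphere (n + 1) => U₂ θ :=
    hU₂.continuousOn.comp_continuous hcoe fun θ => θ.coe_ne_zero
  have habs : ∀ {U : Euc (n + 1) → ℝ}, (∀ x, U x ∈ Icc (0 : ℝ) 1) → ∀ x, |U x| ≤ 1 := fun h x => by
    rw [abs_of_nonneg (h x).1]; exact (h x).2
  -- ranges of the perturbed radii
  have hrange : ∀ {t a : ℝ}, |t| < R / 2 → a ∈ Icc (0 : ℝ) 1 →
      0 < R + t * a ∧ R + t * a ≤ 2 * R := by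
    intro t a ht ha
    have : |t * a| ≤ R / 2 := by
      rw [abs_mul, abs_of_nonneg ha.1]
      exact (mul_le_of_le_one_right (abs_nonneg t) ha.2).trans ht.le
    have := abs_le.1 this
    constructor <;> linarith [this.1, this.2]
  -- continuity and integrability along a single perturbation
  have hcont : ∀ {U : Euc (n + 1) → ℝ}, (Continuous fun θ : USphere (n + 1) => U θ) →
      (∀ x, U x ∈ Icc (0 : ℝ) 1) → ∀ t, |t| < R / 2 →
      ContinuousOn (fun θ : USphere (n + 1) => radialDensity φ (R + t * U θ) θ) ω := by
    intro U hU hI t ht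
    exact hf.comp ((continuous_const.add (continuous_const.mul hU)).continuousOn.prodMk
      continuousOn_id) fun θ hθ => ⟨(hrange ht (hI θ)).1, hθ⟩
  have hcontM : ∀ {U : Euc (n + 1) → ℝ}, (Continuous fun θ : USphere (n + 1) => U θ) →
      (∀ x, U x ∈ Icc (0 : ℝ) 1) → ∀ t, |t| < R / 2 →
      ContinuousOn (fun θ : USphere (n + 1) => radialMass φ (R + t * U θ) θ) ω := by
    intro U hU hI t ht
    exact continuousOn_radialMass_comp (q := fun θ : USphere (n + 1) => R + t * U θ) (ρ := 2 * R)
      hφc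
      (continuous_const.add (continuous_const.mul hU)).continuousOn
      (fun θ _ => (hrange ht (hI θ)).1) fun θ _ => (hrange ht (hI θ)).2
  have hsubK : ∀ {K : Set (USphere (n + 1))}, K ⊆ ω →
      (Ioi (0 : ℝ) ×ˢ K ⊆ Ioi (0 : ℝ) ×ˢ ω) := fun h => prod_mono subset_rfl h
  -- derivatives of mass and perimeter
  have hdp : ∀ {U : Euc (n + 1) → ℝ} {K : Set (USphere (n + 1))},
      (Continuous fun θ : USphere (n + 1) => U θ) → (∀ x, U x ∈ Icc (0 : ℝ) 1) → IsClosed K →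
      K ⊆ ω → HasDerivAt (fun t => ∫ θ in K, radialDensity φ (R + t * U θ) θ
        ∂(surfaceMeasure (n + 1)))
        (∫ θ in K, radialDensityDeriv φ R θ * U θ ∂(surfaceMeasure (n + 1))) 0 := by
    intro U K hU hI hK hKω
    have := hasDerivAt_setIntegral_radial (g := radialDensity φ) (g' := radialDensityDeriv φ)
      (R := R) (t₀ := 0) hK hU.continuousOn (fun θ _ => habs hI θ)
      (fun t ht => (hcont hU hI t ht).mono hKω) (hf'.mono (hsubK hKω))
      (fun θ hθ r hr => hasDerivAt_radialDensity hω hφ (hKω hθ) hr)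
      (by rw [abs_zero]; positivity)
    simpa only [zero_mul, add_zero] using this
  have hdv : ∀ {U : Euc (n + 1) → ℝ} {K : Set (USphere (n + 1))},
      (Continuous fun θ : USphere (n + 1) => U θ) → (∀ x, U x ∈ Icc (0 : ℝ) 1) → IsClosed K →
      K ⊆ ω → HasStrictDerivAt (fun t => ∫ θ in K, radialMass φ (R + t * U θ) θ
        ∂(surfaceMeasure (n + 1)))
        (∫ θ in K, radialDensity φ R θ * U θ ∂(surfaceMeasure (n + 1))) 0 := by
    intro U K hU hI hK hKω
    have h1 : ∀ᶠ t in 𝓝 (0 : ℝ), HasDerivAt (fun t => ∫ θ in K, radialMass φ (R + t * U θ) θ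
        ∂(surfaceMeasure (n + 1)))
        (∫ θ in K, radialDensity φ (R + t * U θ) θ * U θ ∂(surfaceMeasure (n + 1))) t := by
      have h0 : {t : ℝ | |t| < R / 2} ∈ 𝓝 0 :=
        (isOpen_lt continuous_abs continuous_const).mem_nhds (by simpa using hR)
      filter_upwards [h0] with t ht
      exact hasDerivAt_setIntegral_radial (g := radialMass φ) (g' := radialDensity φ)
        hK hU.continuousOn (fun θ _ => habs hI θ)
        (fun t ht => (hcontM hU hI t ht).mono hKω) (hf.mono (hsubK hKω))
        (fun θ hθ r hr => hasDerivAt_radialMass hφc (hKω hθ) hr) ht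
    have hUp : ContinuousOn (fun p : ℝ × USphere (n + 1) => U p.2) (Ioi 0 ×ˢ K) :=
      (hU.comp continuous_snd).continuousOn
    have h2 := hasDerivAt_setIntegral_radial (g := fun r θ => radialDensity φ r θ * U θ)
      (g' := fun r θ => radialDensityDeriv φ r θ * U θ)
      (R := R) (t₀ := 0) hK hU.continuousOn (fun θ _ => habs hI θ)
      (fun t ht => ((hcont hU hI t ht).mono hKω).mul hU.continuousOn)
      ((hf'.mono (hsubK hKω)).mul hUp)
      (fun θ hθ r hr => (hasDerivAt_radialDensity hω hφ (hKω hθ) hr).mul_const _)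
      (by rw [abs_zero]; positivity)
    have h3 := hasStrictDerivAt_of_hasDerivAt_of_continuousAt h1 h2.continuousAt
    simpa only [zero_mul, add_zero] using h3
  have hvpos₁ : 0 < ∫ θ in K₁, radialDensity φ R θ * U₁ θ ∂(surfaceMeasure (n + 1)) :=
    setIntegral_pos_of_continuousOn hK₁ hO₁ ⟨θ₁, hθO₁⟩ hOK₁
      ((hfR.mono hK₁ω).mul hu₁.continuousOn)
      (fun θ hθ => mul_nonneg (radialDensity_pos hφpos (hK₁ω hθ) hR).le (hI₁ θ).1)
      fun θ hθ => mul_pos (radialDensity_pos hφpos (hK₁ω (hOK₁ hθ)) hR) (hp₁ θ hθ)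
  have hvpos₂ : 0 < ∫ θ in K₂, radialDensity φ R θ * U₂ θ ∂(surfaceMeasure (n + 1)) :=
    setIntegral_pos_of_continuousOn hK₂ hO₂ ⟨θ₂, hθO₂⟩ hOK₂
      ((hfR.mono hK₂ω).mul hu₂.continuousOn)
      (fun θ hθ => mul_nonneg (radialDensity_pos hφpos (hK₂ω hθ) hR).le (hI₂ θ).1)
      fun θ hθ => mul_pos (radialDensity_pos hφpos (hK₂ω (hOK₂ hθ)) hR) (hp₂ θ hθ)
  have hint : ∀ {K : Set (USphere (n + 1))} {g : USphere (n + 1) → ℝ} {U : Euc (n + 1) → ℝ},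
      IsClosed K → K ⊆ ω → ContinuousOn g ω → (Continuous fun θ : USphere (n + 1) => U θ) →
      IntegrableOn (fun θ => g θ * U θ) K (surfaceMeasure (n + 1)) := fun hK hKω hg hU =>
    ((hg.mono hKω).mul hU.continuousOn).integrableOn_compact hK.isCompact
  have hineq₁ : ∫ θ in K₁, radialDensityDeriv φ R θ * U₁ θ ∂(surfaceMeasure (n + 1)) <
      c * ∫ θ in K₁, radialDensity φ R θ * U₁ θ ∂(surfaceMeasure (n + 1)) := by
    have h := setIntegral_pos_of_continuousOn hK₁ hO₁ ⟨θ₁, hθO₁⟩ hOK₁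
      (g := fun θ => c * (radialDensity φ R θ * U₁ θ) - radialDensityDeriv φ R θ * U₁ θ)
      ((continuousOn_const.mul ((hfR.mono hK₁ω).mul hu₁.continuousOn)).sub
        ((hfR'.mono hK₁ω).mul hu₁.continuousOn))
      (fun θ hθ => by
        have a : radialDensityDeriv φ R θ - c * radialDensity φ R θ < 0 := (hKV₁ hθ).2
        nlinarith [(hI₁ θ).1])
      (fun θ hθ => by
        have a : radialDensityDeriv φ R θ - c * radialDensity φ R θ < 0 := (hKV₁ (hOK₁ hθ)).2
        nlinarith [hp₁ θ hθ])
    rw [integral_sub ((hint hK₁ hK₁ω hfR hu₁).const_mul c) (hint hK₁ hK₁ω hfR' hu₁),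
      integral_const_mul] at h
    linarith
  have hineq₂ : c * ∫ θ in K₂, radialDensity φ R θ * U₂ θ ∂(surfaceMeasure (n + 1)) <
      ∫ θ in K₂, radialDensityDeriv φ R θ * U₂ θ ∂(surfaceMeasure (n + 1)) := by
    have h := setIntegral_pos_of_continuousOn hK₂ hO₂ ⟨θ₂, hθO₂⟩ hOK₂
      (g := fun θ => radialDensityDeriv φ R θ * U₂ θ - c * (radialDensity φ R θ * U₂ θ))
      (((hfR'.mono hK₂ω).mul hu₂.continuousOn).sub
        (continuousOn_const.mul ((hfR.mono hK₂ω).mul hu₂.continuousOn)))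
      (fun θ hθ => by
        have a : 0 < radialDensityDeriv φ R θ - c * radialDensity φ R θ := (hKV₂ hθ).2
        nlinarith [(hI₂ θ).1])
      (fun θ hθ => by
        have a : 0 < radialDensityDeriv φ R θ - c * radialDensity φ R θ := (hKV₂ (hOK₂ hθ)).2
        nlinarith [hp₂ θ hθ])
    rw [integral_sub (hint hK₂ hK₂ω hfR' hu₂) ((hint hK₂ hK₂ω hfR hu₂).const_mul c),
      integral_const_mul] at h
    linarith
  -- For `|t|, |s| < R / 4` the radii are at least `R / 2`, and `|∇q| ≤ (|t| + |s|) max C₁ C₂`, so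
  -- that `|∇q|² / (2 q²) ≤ C (t² + s²)` with the constant `C` below.
  have key := deriv_mul_eq_of_constrained_min (δ := R / 4)
    (C := 2 * (2 * (max C₁ C₂) ^ 2) / R ^ 2)
    (P := ∫ θ in ω, radialDensity φ R θ ∂(surfaceMeasure (n + 1)))
    (hdp hu₁ hI₁ hK₁ hK₁ω) (hdp hu₂ hI₂ hK₂ hK₂ω) (hdv hu₁ hI₁ hK₁ hK₁ω).hasDerivAt
    (hdv hu₂ hI₂ hK₂ hK₂ω) hvpos₂.ne' (by positivity) ?_
  · have := mul_lt_mul_of_pos_right hineq₁ hvpos₂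
    have := mul_lt_mul_of_pos_right hineq₂ hvpos₁
    nlinarith
  intro t s ht hs hv
  simp only [zero_mul, add_zero] at hv ⊢
  have hΩ0 : coneOver ω ⊆ ({0}ᶜ : Set (Euc (n + 1))) := fun x hx => hx.1
  set q : Euc (n + 1) → ℝ := fun x => R + t * U₁ x + s * U₂ x with hq
  have hqd : ContDiffOn ℝ 1 q (coneOver ω) :=
    ((contDiffOn_const.add (contDiffOn_const.mul hU₁)).add (contDiffOn_const.mul hU₂)).mono hΩ0
  have hqr : ∀ x, R / 2 ≤ q x ∧ q x ≤ 2 * R := by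
    intro x
    have h1 : |t * U₁ x| ≤ R / 4 := by
      rw [abs_mul]
      exact (mul_le_of_le_one_right (abs_nonneg t) (habs hI₁ x)).trans ht.le
    have h2 : |s * U₂ x| ≤ R / 4 := by
      rw [abs_mul]
      exact (mul_le_of_le_one_right (abs_nonneg s) (habs hI₂ x)).trans hs.le
    have h1' := abs_le.1 h1
    have h2' := abs_le.1 h2
    simp only [hq]
    constructor <;> linarith [h1'.1, h1'.2, h2'.1, h2'.2]
  have hqpos : ∀ x, 0 < q x := fun x => lt_of_lt_of_le (by positivity) (hqr x).1
  have hqc : Continuous fun θ : USphere (n + 1) => q θ :=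
    (continuous_const.add (continuous_const.mul hu₁)).add (continuous_const.mul hu₂)
  have ht' : |t| < R / 2 := by linarith
  have hs' : |s| < R / 2 := by linarith
  have hcR : ContinuousOn (fun _ : USphere (n + 1) => R) ω := continuousOn_const
  have hR2 : (0 : ℝ) ≤ 2 * R := by positivity
  have hc₁ : ContinuousOn (fun θ : USphere (n + 1) => R + t * U₁ θ) ω :=
    (continuous_const.add (continuous_const.mul hu₁)).continuousOn
  have hc₂ : ContinuousOn (fun θ : USphere (n + 1) => R + s * U₂ θ) ω :=
    (continuous_const.add (continuous_const.mul hu₂)).continuousOn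
  have hmass := setIntegral_perturb_split hω hK₁ hK₂ hK₁ω hK₂ω hdisj (g := radialMass φ) (R := R)
    (t := t) (s := s)
    (fun θ _ => hz₁ θ) (fun θ _ => hz₂ θ)
    (integrableOn_radialMass_comp hω hφc hcR hR.le (fun _ _ => hR) fun _ _ => le_rfl)
    (integrableOn_radialMass_comp hω hφc hc₁ hR2 (fun θ _ => (hrange ht' (hI₁ θ)).1)
      fun θ _ => (hrange ht' (hI₁ θ)).2)
    (integrableOn_radialMass_comp hω hφc hc₂ hR2 (fun θ _ => (hrange hs' (hI₂ θ)).1)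
      fun θ _ => (hrange hs' (hI₂ θ)).2)
  have hIR := integrableOn_radialDensity_comp hω hφc hcR hR.le (fun _ _ => hR) fun _ _ => le_rfl
  have hIq := integrableOn_radialDensity_comp hω hφc (q := fun θ : USphere (n + 1) => q θ)
    hqc.continuousOn hR2 (fun θ _ => hqpos θ) fun θ _ => (hqr θ).2
  have hper := setIntegral_perturb_split hω hK₁ hK₂ hK₁ω hK₂ω hdisj (g := radialDensity φ) (R := R)
    (t := t) (s := s)
    (fun θ _ => hz₁ θ) (fun θ _ => hz₂ θ) hIR
    (integrableOn_radialDensity_comp hω hφc hc₁ hR2 (fun θ _ => (hrange ht' (hI₁ θ)).1)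
      fun θ _ => (hrange ht' (hI₁ θ)).2)
    (integrableOn_radialDensity_comp hω hφc hc₂ hR2 (fun θ _ => (hrange hs' (hI₂ θ)).1)
      fun θ _ => (hrange hs' (hI₂ θ)).2)
  have hiso' := lintegral_radialDensity_le_of_mass_eq hω hφ hφc hφpos hR hiso hqd
    (fun x _ => hqpos x) (fun x _ r hr => by simp only [hq, hhom₁ x r hr, hhom₂ x r hr]) hR2
    (fun x _ => (hqr x).2) (by rw [hmass, add_assoc, hv, add_zero])
  have hgrad : ∀ θ : USphere (n + 1), ‖gradient q θ‖ ^ 2 / (2 * q θ ^ 2) ≤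
      2 * (2 * (max C₁ C₂) ^ 2) / R ^ 2 * (t ^ 2 + s ^ 2) := by
    intro θ
    have hd₁ := (hU₁.contDiffAt (isOpen_compl_singleton.mem_nhds θ.coe_ne_zero)).differentiableAt
      one_ne_zero
    have hd₂ := (hU₂.contDiffAt (isOpen_compl_singleton.mem_nhds θ.coe_ne_zero)).differentiableAt
      one_ne_zero
    have h1 : fderiv ℝ q θ = t • fderiv ℝ U₁ θ + s • fderiv ℝ U₂ θ :=
      ((((hd₁.hasFDerivAt.const_mul t).const_add R)).add (hd₂.hasFDerivAt.const_mul s)).fderiv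
    set C := max C₁ C₂
    have h2 : ‖gradient q θ‖ ≤ (|t| + |s|) * C := by
      rw [norm_gradient_eq_norm_fderiv, h1]
      refine (norm_add_le _ _).trans ?_
      rw [norm_smul, norm_smul, Real.norm_eq_abs, Real.norm_eq_abs, add_mul]
      gcongr
      · exact (hC₁ θ).trans (le_max_left _ _)
      · exact (hC₂ θ).trans (le_max_right _ _)
    have h3 : ‖gradient q θ‖ ^ 2 ≤ 2 * (t ^ 2 + s ^ 2) * C ^ 2 := by
      calc ‖gradient q θ‖ ^ 2 ≤ ((|t| + |s|) * C) ^ 2 := by gcongr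
        _ = (|t| + |s|) ^ 2 * C ^ 2 := by ring
        _ ≤ _ := by
          gcongr
          have := sq_nonneg (|t| - |s|)
          rw [← sq_abs t, ← sq_abs s]
          linarith
    have h4 : R ^ 2 / 2 ≤ 2 * q θ ^ 2 := by
      have : (R / 2) ^ 2 ≤ q θ ^ 2 := by gcongr; exact (hqr θ).1
      linarith
    calc ‖gradient q θ‖ ^ 2 / (2 * q θ ^ 2) ≤ 2 * (t ^ 2 + s ^ 2) * C ^ 2 / (R ^ 2 / 2) := by
          gcongr
      _ = _ := by field_simp
  set D : ℝ := 2 * (2 * (max C₁ C₂) ^ 2) / R ^ 2 with hD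
  have hD0 : 0 ≤ D := by positivity
  rw [← hper]
  have hfq0 : ∀ θ ∈ ω, 0 ≤ radialDensity φ (q θ) θ := fun θ hθ =>
    (radialDensity_pos hφpos hθ (hqpos θ)).le
  rw [← integral_const_mul]
  have h5 : ENNReal.ofReal (∫ θ in ω, radialDensity φ R θ ∂(surfaceMeasure (n + 1))) ≤
      ENNReal.ofReal (∫ θ in ω, (1 + D * (t ^ 2 + s ^ 2)) *
        radialDensity φ (R + t * U₁ θ + s * U₂ θ) θ ∂(surfaceMeasure (n + 1))) := by
    rw [ofReal_integral_eq_lintegral_ofReal hIR, ofReal_integral_eq_lintegral_ofReal]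
    · refine hiso'.trans (setLIntegral_mono' hω.measurableSet fun θ hθ =>
        ENNReal.ofReal_le_ofReal ?_)
      rw [mul_comm]
      have := hfq0 θ hθ
      simp only [hq] at this ⊢
      gcongr
      exact hgrad θ
    · exact hIq.const_mul _
    · filter_upwards [ae_restrict_mem hω.measurableSet] with θ hθ
      exact mul_nonneg (by positivity) (hfq0 θ hθ)
    · filter_upwards [ae_restrict_mem hω.measurableSet] with θ hθ
      exact (radialDensity_pos hφpos hθ hR).le
  refine (ENNReal.ofReal_le_ofReal_iff ?_).1 h5
  exact setIntegral_nonneg hω.measurableSet fun θ hθ => mul_nonneg (by positivity) (hfq0 θ hθ)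

/-- The logarithmic radial derivative of the density on the sphere of radius `R` does not depend on
the direction. -/
theorem radialDensityDeriv_mul_comm (hω : IsOpen ω) {φ : Euc (n + 1) → ℝ}
    (hφ : ContDiffOn ℝ 1 φ (coneOver ω)) (hφc : ContinuousOn φ (closure (coneOver ω)))
    (hφpos : ∀ x ∈ coneOver ω, 0 < φ x) {R : ℝ} (hR : 0 < R)
    (hiso : isoperimetricProfile φ (coneOver ω)
          (weightedMeasure φ (coneOver ω) (ball 0 R ∩ coneOver ω)) =
        weightedPerimeter φ (ball 0 R ∩ coneOver ω) (coneOver ω))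
    {θ₁ θ₂ : USphere (n + 1)} (hθ₁ : θ₁ ∈ ω) (hθ₂ : θ₂ ∈ ω) :
    radialDensityDeriv φ R θ₁ * radialDensity φ R θ₂ =
      radialDensityDeriv φ R θ₂ * radialDensity φ R θ₁ := by
  have key : ∀ θ₁ ∈ ω, ∀ θ₂ ∈ ω, radialDensityDeriv φ R θ₂ / radialDensity φ R θ₂ ≤
      radialDensityDeriv φ R θ₁ / radialDensity φ R θ₁ := by
    intro θ₁ hθ₁ θ₂ hθ₂
    by_contra! h
    obtain ⟨c, hc₁, hc₂⟩ := exists_between h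
    exact not_radialDensityDeriv_lt hω hφ hφc hφpos hR hiso hθ₁ hθ₂
      ((div_lt_iff₀ (radialDensity_pos hφpos hθ₁ hR)).1 hc₁)
      ((lt_div_iff₀ (radialDensity_pos hφpos hθ₂ hR)).1 hc₂)
  have h := le_antisymm (key θ₁ hθ₁ θ₂ hθ₂) (key θ₂ hθ₂ θ₁ hθ₁)
  rw [div_eq_div_iff (radialDensity_pos hφpos hθ₂ hR).ne' (radialDensity_pos hφpos hθ₁ hR).ne'] at h
  exact h.symm

/-- The product structure of the weight: the quotient of the densities along two rays has
derivative zero. -/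
theorem eq_mul_div_of_isoperimetric (hω : IsOpen ω) {φ : Euc (n + 1) → ℝ}
    (hφ : ContDiffOn ℝ 1 φ (coneOver ω)) (hφc : ContinuousOn φ (closure (coneOver ω)))
    (hφpos : ∀ x ∈ coneOver ω, 0 < φ x)
    (hiso : ∀ R : ℝ, 0 < R → isoperimetricProfile φ (coneOver ω)
          (weightedMeasure φ (coneOver ω) (ball 0 R ∩ coneOver ω)) =
        weightedPerimeter φ (ball 0 R ∩ coneOver ω) (coneOver ω))
    {θ₀ θ : USphere (n + 1)} (hθ₀ : θ₀ ∈ ω) (hθ : θ ∈ ω) {r : ℝ} (hr : 0 < r) :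
    φ (r • (θ : Euc (n + 1))) =
      φ (r • (θ₀ : Euc (n + 1))) * (φ (θ : Euc (n + 1)) / φ (θ₀ : Euc (n + 1))) := by
  have hd : ∀ s ∈ Ioi (0 : ℝ), HasDerivAt (fun s => radialDensity φ s θ / radialDensity φ s θ₀)
      0 s := by
    intro s hs
    have h1 := (hasDerivAt_radialDensity hω hφ hθ hs).div (hasDerivAt_radialDensity hω hφ hθ₀ hs)
      (radialDensity_pos hφpos hθ₀ hs).ne'
    refine h1.congr_deriv ?_
    rw [radialDensityDeriv_mul_comm hω hφ hφc hφpos hs (hiso s hs) hθ hθ₀, mul_comm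
      (radialDensity φ s θ), sub_self, zero_div]
  obtain ⟨a, ha⟩ := isOpen_Ioi.exists_is_const_of_deriv_eq_zero isPreconnected_Ioi
    (fun s hs => (hd s hs).differentiableAt.differentiableWithinAt) (fun s hs => (hd s hs).deriv)
  have h1 := (ha r hr).trans (ha 1 (by norm_num : (1 : ℝ) ∈ Ioi 0)).symm
  have hp1 := hφpos _ ((smul_mem_coneOver hr θ₀).2 hθ₀)
  have hp2 := hφpos _ ((coe_mem_coneOver θ₀).2 hθ₀)
  have hrn : r ^ n ≠ 0 := (pow_pos hr n).ne'
  simp only [radialDensity, one_pow, one_smul, one_mul] at h1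
  rw [mul_div_mul_left _ _ hrn, div_eq_iff hp1.ne'] at h1
  rw [h1, mul_comm]

/-! ### The second variation -/

/-- A local inverse `H` of a primitive `G` of `a`, together with the neighbourhood on which it is
differentiable and takes values close to `R`. -/
theorem exists_local_inverse {G a : ℝ → ℝ} {R ε : ℝ} (hε : 0 < ε)
    (hG : ∀ᶠ r in 𝓝 R, HasDerivAt G (a r) r) (ha : ∀ᶠ r in 𝓝 R, ContinuousAt a r)
    (ha0 : ∀ᶠ r in 𝓝 R, a r ≠ 0) :
    ∃ (H : ℝ → ℝ) (δ : ℝ), 0 < δ ∧ ∀ w, |w - G R| < δ →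
      G (H w) = w ∧ |H w - R| < ε ∧ HasDerivAt H (a (H w))⁻¹ w ∧ ContDiffAt ℝ 1 H w := by
  have hs : HasStrictDerivAt G (a R) R :=
    hasStrictDerivAt_of_hasDerivAt_of_continuousAt hG ha.self_of_nhds
  let e := hs.hasStrictFDerivAt_equiv ha0.self_of_nhds |>.toOpenPartialHomeomorph G
  have heG : (e : ℝ → ℝ) = G := HasStrictFDerivAt.toOpenPartialHomeomorph_coe _
  have hRs : R ∈ e.source := HasStrictFDerivAt.mem_toOpenPartialHomeomorph_source _
  have hsymm : e.symm (G R) = R := by rw [← heG]; exact e.left_inv hRs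
  have htar : e.target ∈ 𝓝 (G R) := by
    rw [← heG]; exact e.open_target.mem_nhds (e.map_source hRs)
  have hcont : Tendsto e.symm (𝓝 (G R)) (𝓝 R) := by
    have h := e.continuousAt_symm (x := G R) (mem_of_mem_nhds htar)
    rwa [ContinuousAt, hsymm] at h
  have hball : ∀ᶠ r in 𝓝 R, |r - R| < ε := by
    exact (isOpen_lt (by fun_prop) continuous_const).mem_nhds (by simpa using hε)
  have hnice := hcont.eventually ((hG.eventually_nhds.and ha.eventually_nhds).and (ha0.and hball))
  obtain ⟨δ, hδ, hsub⟩ := Metric.eventually_nhds_iff.1 (hnice.and htar)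
  refine ⟨e.symm, δ, hδ, fun w hw => ?_⟩
  obtain ⟨⟨⟨h1, h2⟩, h3, h4⟩, h5⟩ := hsub (show dist w (G R) < δ from hw)
  have hd : HasDerivAt e (a (e.symm w)) (e.symm w) := by rw [heG]; exact h1.self_of_nhds
  refine ⟨by rw [← heG]; exact e.right_inv h5, h4, e.hasDerivAt_symm h5 h3 hd, ?_⟩
  refine e.contDiffAt_symm_deriv h3 h5 hd ?_
  rw [heG]
  have h6 : ContDiffAt ℝ 1 G (e.symm w) := by
    rw [contDiffAt_one_iff]
    obtain ⟨u, hu, hu1, hu2⟩ := _root_.eventually_nhds_iff.1 (h1.and h2)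
    refine ⟨fun r => ContinuousLinearMap.toSpanSingleton ℝ (a r), u, hu1.mem_nhds hu2, ?_,
      fun x hx => (hu x hx).1.hasFDerivAt⟩
    exact (ContinuousLinearMap.toSpanSingletonCLE (𝕜 := ℝ) (E := ℝ)).continuous.comp_continuousOn
      fun x hx => (hu x hx).2.continuousWithinAt
  exact h6

/-- Near `R`, the density `a`, as a function of the mass `G`, lies below any parabola that is
tangent to it at `R` and has a larger second derivative: with `l = a' / a`, the first derivative
of `a` with respect to `G` is `l`, and the second one is `l' / a`. -/
theorem eventually_le_quadratic {G a l : ℝ → ℝ} {R l' K : ℝ}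
    (hG : ∀ᶠ r in 𝓝 R, HasDerivAt G (a r) r) (ha : ∀ᶠ r in 𝓝 R, HasDerivAt a (a r * l r) r)
    (hl : HasDerivAt l l' R) (ha0 : 0 < a R) (hK : l' / a R < K) :
    ∀ᶠ r in 𝓝 R, a r ≤ a R + l R * (G r - G R) + K / 2 * (G r - G R) ^ 2 := by
  set p : ℝ → ℝ := fun r => a r - (a R + l R * (G r - G R) + K / 2 * (G r - G R) ^ 2) with hp
  have hp1 : ∀ᶠ r in 𝓝 R, HasDerivAt p (a r * l r - (l R * a r + K * (G r - G R) * a r)) r := by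
    filter_upwards [hG, ha] with r h1 h2
    have h3 := h2.sub ((((h1.sub_const (G R)).const_mul (l R)).const_add (a R)).add
      (((h1.sub_const (G R)).pow 2).const_mul (K / 2)))
    refine h3.congr_deriv ?_
    simp
    ring
  have hGR := hG.self_of_nhds
  have haR := ha.self_of_nhds
  have hp2 : HasDerivAt (fun r => a r * l r - (l R * a r + K * (G r - G R) * a r))
      (a R * l' - K * a R ^ 2) R := by
    have h3 := (haR.mul hl).sub ((haR.const_mul (l R)).add
      (((hGR.sub_const (G R)).const_mul K).mul haR))
    refine h3.congr_deriv ?_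
    simp
    ring
  have hdd : deriv (deriv p) R = a R * l' - K * a R ^ 2 := by
    have : deriv p =ᶠ[𝓝 R] fun r => a r * l r - (l R * a r + K * (G r - G R) * a r) := by
      filter_upwards [hp1] with r hr using hr.deriv
    rw [this.deriv_eq, hp2.deriv]
  have hneg : deriv (deriv p) R < 0 := by
    rw [hdd]
    have := (div_lt_iff₀ ha0).1 hK
    nlinarith
  have hmax := isLocalMax_of_deriv_deriv_neg hneg
    (by rw [hp1.self_of_nhds.deriv]; ring) hp1.self_of_nhds.continuousAt
  filter_upwards [hmax] with r hr
  have e : p R = 0 := by simp [hp]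
  rw [e] at hr
  simp only [hp] at hr
  linarith

/-- The second variation at the sphere of radius `R`, for a density `a(r) B(θ)` in polar
coordinates. The competitor is the graph of `G⁻¹(G(R) + t U)`, with `G` the primitive of `a`; it
has exactly the mass of the ball, since `U` has mean zero. -/
theorem second_variation_of_bounded (hω : IsOpen ω) {φ : Euc (n + 1) → ℝ}
    (hφ : ContDiffOn ℝ 1 φ (coneOver ω)) (hφc : ContinuousOn φ (closure (coneOver ω)))
    (hφpos : ∀ x ∈ coneOver ω, 0 < φ x) {R : ℝ} (hR : 0 < R)
    (hiso : isoperimetricProfile φ (coneOver ω)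
          (weightedMeasure φ (coneOver ω) (ball 0 R ∩ coneOver ω)) =
        weightedPerimeter φ (ball 0 R ∩ coneOver ω) (coneOver ω))
    {a l G : ℝ → ℝ} {l' : ℝ} {B : USphere (n + 1) → ℝ}
    (hdens : ∀ r, 0 < r → ∀ θ ∈ ω, radialDensity φ r θ = a r * B θ)
    (hmass : ∀ r, 0 < r → ∀ θ ∈ ω, radialMass φ r θ = G r * B θ)
    (hapos : ∀ r, 0 < r → 0 < a r) (hG : ∀ r, 0 < r → HasDerivAt G (a r) r)
    (hal : ∀ r, 0 < r → HasDerivAt a (a r * l r) r) (hl : HasDerivAt l l' R)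
    (hBpos : ∀ θ ∈ ω, 0 < B θ) (hBi : IntegrableOn B ω (surfaceMeasure (n + 1)))
    {U : Euc (n + 1) → ℝ} (hU : ContDiffOn ℝ 1 U (coneOver ω))
    (hUhom : ∀ x ∈ coneOver ω, ∀ r : ℝ, 0 < r → U (r • x) = U x) {M : ℝ}
    (hUM : ∀ x ∈ coneOver ω, |U x| ≤ M)
    (hUB : IntegrableOn (fun θ : USphere (n + 1) => U θ * B θ) ω (surfaceMeasure (n + 1)))
    (hUB0 : ∫ θ in ω, U θ * B θ ∂(surfaceMeasure (n + 1)) = 0)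
    (hU2 : IntegrableOn (fun θ : USphere (n + 1) => U θ ^ 2 * B θ) ω (surfaceMeasure (n + 1)))
    (hD : IntegrableOn (fun θ : USphere (n + 1) => ‖gradient U θ‖ ^ 2 * B θ) ω
      (surfaceMeasure (n + 1))) :
    -R ^ 2 * l' * ∫ θ in ω, U θ ^ 2 * B θ ∂(surfaceMeasure (n + 1)) ≤
      ∫ θ in ω, ‖gradient U θ‖ ^ 2 * B θ ∂(surfaceMeasure (n + 1)) := by
  have hΩ := isOpen_coneOver hω
  have hmem : ∀ {θ : USphere (n + 1)}, θ ∈ ω → (θ : Euc (n + 1)) ∈ coneOver ω :=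
    fun hθ => (coe_mem_coneOver _).2 hθ
  set V := ∫ θ in ω, U θ ^ 2 * B θ ∂(surfaceMeasure (n + 1)) with hV
  set D := ∫ θ in ω, ‖gradient U θ‖ ^ 2 * B θ ∂(surfaceMeasure (n + 1)) with hDdef
  have haR := hapos R hR
  have hpos_ev : ∀ᶠ r in 𝓝 R, 0 < r := Ioi_mem_nhds hR
  have hM : 0 ≤ |M| := abs_nonneg M
  -- the inequality up to an arbitrarily small error in both coefficients
  have key : ∀ ε, 0 < ε → 0 ≤ (l' / a R + ε) * V + ((a R * R ^ 2)⁻¹ + ε) * D := by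
    intro ε hε
    have hquad := eventually_le_quadratic (hpos_ev.mono hG) (hpos_ev.mono hal) hl haR
      (lt_add_of_pos_right (l' / a R) hε)
    have hinv : ∀ᶠ r in 𝓝 R, (a r * r ^ 2)⁻¹ < (a R * R ^ 2)⁻¹ + ε := by
      have hc : ContinuousAt (fun r => (a r * r ^ 2)⁻¹) R :=
        ((hal R hR).continuousAt.mul (by fun_prop)).inv₀ (mul_pos haR (pow_pos hR 2)).ne'
      exact hc.eventually_lt continuousAt_const (by linarith)
    obtain ⟨ε', hε', hnear⟩ := Metric.eventually_nhds_iff.1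
      (hpos_ev.and (hquad.and (hinv.and (Iio_mem_nhds (show R < 2 * R by linarith)))))
    obtain ⟨H, δ, hδ, hH⟩ := exists_local_inverse hε' (hpos_ev.mono hG)
      (hpos_ev.mono fun r hr => (hal r hr).continuousAt)
      (hpos_ev.mono fun r hr => (hapos r hr).ne')
    -- small enough for `G R + t U` to stay in the domain of the local inverse
    set t : ℝ := δ / (2 * (|M| + 1)) with ht
    have ht0 : 0 < t := by positivity
    have htU : ∀ x ∈ coneOver ω, |G R + t * U x - G R| < δ := by
      intro x hx
      rw [add_sub_cancel_left, abs_mul, abs_of_pos ht0]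
      calc t * |U x| ≤ t * (|M| + 1) := by
            gcongr
            exact ((hUM x hx).trans (le_abs_self M)).trans (by linarith)
        _ = δ / 2 := by rw [ht]; field_simp
        _ < δ := by linarith
    set q : Euc (n + 1) → ℝ := fun x => H (G R + t * U x) with hq
    have hqn : ∀ x ∈ coneOver ω, 0 < q x ∧ (a (q x) ≤ a R + l R * (G (q x) - G R) +
        (l' / a R + ε) / 2 * (G (q x) - G R) ^ 2) ∧
        (a (q x) * q x ^ 2)⁻¹ < (a R * R ^ 2)⁻¹ + ε ∧ q x < 2 * R := by
      intro x hx
      have h2 := (hH _ (htU x hx)).2.1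
      exact hnear (show dist (q x) R < ε' from h2)
    have hGq : ∀ x ∈ coneOver ω, G (q x) = G R + t * U x := fun x hx => (hH _ (htU x hx)).1
    have hqd : ContDiffOn ℝ 1 q (coneOver ω) := fun x hx =>
      (hH _ (htU x hx)).2.2.2.comp_contDiffWithinAt x
        (contDiffWithinAt_const.add (contDiffWithinAt_const.mul (hU x hx)))
    have hgrad : ∀ x ∈ coneOver ω, ‖gradient q x‖ = (a (q x))⁻¹ * (t * ‖gradient U x‖) := by
      intro x hx
      have h1 := (hH _ (htU x hx)).2.2.1
      have h2 := ((hU.contDiffAt (hΩ.mem_nhds hx)).differentiableAt one_ne_zero).hasFDerivAt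
      have h3 := h1.comp_hasFDerivAt x ((h2.const_mul t).const_add (G R))
      have h4 : fderiv ℝ q x = _ := h3.fderiv
      have h5 : 0 < (a (q x))⁻¹ := inv_pos.2 (hapos _ (hqn x hx).1)
      rw [norm_gradient_eq_norm_fderiv, norm_gradient_eq_norm_fderiv, h4, norm_smul, norm_smul,
        Real.norm_of_nonneg h5.le, Real.norm_of_nonneg ht0.le]
    have hqc : ContinuousOn (fun θ : USphere (n + 1) => q θ) ω :=
      hqd.continuousOn.comp (by fun_prop) fun θ hθ => hmem hθ
    have hmass' : ∫ θ in ω, radialMass φ (q θ) θ ∂(surfaceMeasure (n + 1)) =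
        ∫ θ in ω, radialMass φ R θ ∂(surfaceMeasure (n + 1)) := by
      have e1 : ∫ θ in ω, radialMass φ (q θ) θ ∂(surfaceMeasure (n + 1)) =
          ∫ θ in ω, (G R * B θ + t * (U θ * B θ)) ∂(surfaceMeasure (n + 1)) := by
        refine setIntegral_congr_fun hω.measurableSet fun θ hθ => ?_
        rw [hmass _ (hqn θ (hmem hθ)).1 θ hθ, hGq θ (hmem hθ)]
        ring
      rw [e1, integral_add (hBi.const_mul _) (hUB.const_mul _), integral_const_mul t, hUB0,
        mul_zero, add_zero]
      exact setIntegral_congr_fun hω.measurableSet fun θ hθ => (hmass R hR θ hθ).symm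
    have hineq := lintegral_radialDensity_le_of_mass_eq hω hφ hφc hφpos hR hiso hqd
      (fun x hx => (hqn x hx).1) (fun x hx r hr => by simp only [hq, hUhom x hx r hr])
      (by positivity : 0 ≤ 2 * R) (fun x hx => (hqn x hx).2.2.2.le) hmass'
    -- the pointwise upper bound for the perimeter density of the graph
    set b : USphere (n + 1) → ℝ := fun θ => a R * B θ + (l R * t) * (U θ * B θ) +
      ((l' / a R + ε) / 2 * t ^ 2) * (U θ ^ 2 * B θ) +
      (t ^ 2 / 2 * ((a R * R ^ 2)⁻¹ + ε)) * (‖gradient U θ‖ ^ 2 * B θ) with hb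
    have hpt : ∀ θ ∈ ω, radialDensity φ (q θ) θ * (1 + ‖gradient q θ‖ ^ 2 / (2 * q θ ^ 2)) ≤
        b θ := by
      intro θ hθ
      obtain ⟨h1, h2, h3, -⟩ := hqn θ (hmem hθ)
      have h4 := hapos _ h1
      have hB := hBpos θ hθ
      rw [hdens _ h1 θ hθ, hgrad θ (hmem hθ)]
      rw [hGq θ (hmem hθ), add_sub_cancel_left] at h2
      have e1 : a (q θ) * B θ * (1 + ((a (q θ))⁻¹ * (t * ‖gradient U θ‖)) ^ 2 / (2 * q θ ^ 2)) =
          a (q θ) * B θ + (t ^ 2 / 2 * (a (q θ) * q θ ^ 2)⁻¹) * (‖gradient U θ‖ ^ 2 * B θ) := by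
        field_simp
      rw [e1]
      have e2 : b θ = (a R + l R * (t * U θ) + (l' / a R + ε) / 2 * (t * U θ) ^ 2) * B θ +
          (t ^ 2 / 2 * ((a R * R ^ 2)⁻¹ + ε)) * (‖gradient U θ‖ ^ 2 * B θ) := by
        simp only [hb]; ring
      rw [e2]
      gcongr
    have hbi : IntegrableOn b ω (surfaceMeasure (n + 1)) :=
      (((hBi.const_mul _).add (hUB.const_mul _)).add (hU2.const_mul _)).add (hD.const_mul _)
    have hb0 : ∀ θ ∈ ω, 0 ≤ b θ := fun θ hθ => by
      refine le_trans (mul_nonneg ?_ (by positivity)) (hpt θ hθ)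
      exact (radialDensity_pos hφpos hθ (hqn θ (hmem hθ)).1).le
    have hint : ∫ θ in ω, b θ ∂(surfaceMeasure (n + 1)) =
        a R * ∫ θ in ω, B θ ∂(surfaceMeasure (n + 1)) + ((l' / a R + ε) / 2 * t ^ 2) * V +
        (t ^ 2 / 2 * ((a R * R ^ 2)⁻¹ + ε)) * D := by
      have i1 : IntegrableOn (fun θ : USphere (n + 1) => a R * B θ + (l R * t) * (U θ * B θ)) ω
        (surfaceMeasure (n + 1)) := (hBi.const_mul _).add (hUB.const_mul _)
      have i2 : IntegrableOn (fun θ : USphere (n + 1) => a R * B θ + (l R * t) * (U θ * B θ) +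
        ((l' / a R + ε) / 2 * t ^ 2) * (U θ ^ 2 * B θ)) ω
        (surfaceMeasure (n + 1)) := i1.add (hU2.const_mul _)
      simp only [hb]
      rw [integral_add i2 (hD.const_mul _), integral_add i1 (hU2.const_mul _),
        integral_add (hBi.const_mul _) (hUB.const_mul _), integral_const_mul, integral_const_mul,
        integral_const_mul, integral_const_mul, hUB0, mul_zero, add_zero]
    -- the terms of order zero agree and the linear term vanishes, so that `t²` can be divided out
    have h5 : ENNReal.ofReal (a R * ∫ θ in ω, B θ ∂(surfaceMeasure (n + 1))) ≤
        ENNReal.ofReal (∫ θ in ω, b θ ∂(surfaceMeasure (n + 1))) := by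
      rw [← integral_const_mul, ofReal_integral_eq_lintegral_ofReal (hBi.const_mul _),
        ofReal_integral_eq_lintegral_ofReal hbi]
      · refine le_trans (le_of_eq ?_) (hineq.trans (setLIntegral_mono' hω.measurableSet
          fun θ hθ => ENNReal.ofReal_le_ofReal (hpt θ hθ)))
        exact setLIntegral_congr_fun hω.measurableSet fun θ hθ => by rw [hdens R hR θ hθ]
      · filter_upwards [ae_restrict_mem hω.measurableSet] with θ hθ using hb0 θ hθ
      · filter_upwards [ae_restrict_mem hω.measurableSet] with θ hθ
        exact mul_nonneg haR.le (hBpos θ hθ).le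
    have h6 := (ENNReal.ofReal_le_ofReal_iff
      (setIntegral_nonneg hω.measurableSet hb0)).1 h5
    rw [hint] at h6
    have h7 : 0 ≤ t ^ 2 / 2 * ((l' / a R + ε) * V + ((a R * R ^ 2)⁻¹ + ε) * D) := by linarith
    exact nonneg_of_mul_nonneg_right h7 (by positivity)
  -- let `ε → 0`
  have hlim : 0 ≤ (l' / a R + 0) * V + ((a R * R ^ 2)⁻¹ + 0) * D := by
    have hc : Continuous fun ε : ℝ => (l' / a R + ε) * V + ((a R * R ^ 2)⁻¹ + ε) * D := by
      fun_prop
    refine ge_of_tendsto (hc.tendsto 0 |>.mono_left (nhdsWithin_le_nhds (s := Ioi 0))) ?_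
    filter_upwards [self_mem_nhdsWithin] with ε hε using key ε hε
  have h8 := mul_nonneg (by positivity : 0 ≤ a R * R ^ 2) hlim
  have e3 : a R * R ^ 2 * ((l' / a R + 0) * V + ((a R * R ^ 2)⁻¹ + 0) * D) =
      R ^ 2 * l' * V + D := by field_simp; ring
  rw [e3] at h8
  linarith

/-! ### Unbounded trial functions -/

/-- The map `s ↦ s / (1 + ε s²)`; for `ε > 0` it is bounded with derivative in `[-1, 1]`, and it
converges to the identity as `ε → 0`. -/
noncomputable def smoothTruncation (ε s : ℝ) : ℝ := s / (1 + ε * s ^ 2)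

theorem smoothTruncation_denom_pos {ε : ℝ} (hε : 0 ≤ ε) (s : ℝ) : 0 < 1 + ε * s ^ 2 := by
  positivity

theorem contDiff_smoothTruncation {ε : ℝ} (hε : 0 ≤ ε) : ContDiff ℝ 1 (smoothTruncation ε) :=
  contDiff_id.div (by fun_prop) fun s => (smoothTruncation_denom_pos hε s).ne'

theorem abs_smoothTruncation_le {ε : ℝ} (hε : 0 ≤ ε) (s : ℝ) : |smoothTruncation ε s| ≤ |s| := by
  rw [smoothTruncation, abs_div, abs_of_pos (smoothTruncation_denom_pos hε s)]
  exact div_le_self (abs_nonneg s) (by nlinarith [mul_nonneg hε (sq_nonneg s)])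

theorem abs_smoothTruncation_le_inv {ε : ℝ} (hε : 0 < ε) (hε1 : ε ≤ 1) (s : ℝ) :
    |smoothTruncation ε s| ≤ ε⁻¹ := by
  rw [smoothTruncation, abs_div, abs_of_pos (smoothTruncation_denom_pos hε.le s),
    div_le_iff₀ (smoothTruncation_denom_pos hε.le s), inv_mul_eq_div, le_div_iff₀ hε]
  rcases le_total |s| 1 with h | h
  · nlinarith [mul_nonneg hε.le (sq_nonneg s), abs_nonneg s]
  · rw [← sq_abs s]
    nlinarith [mul_nonneg hε.le (mul_nonneg (abs_nonneg s) (sub_nonneg.2 h))]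

theorem abs_deriv_smoothTruncation_le {ε : ℝ} (hε : 0 ≤ ε) (s : ℝ) :
    |deriv (smoothTruncation ε) s| ≤ 1 := by
  have hpos := smoothTruncation_denom_pos hε s
  have h1 : HasDerivAt (fun s : ℝ => 1 + ε * s ^ 2) (ε * (2 * s)) s := by
    simpa using ((hasDerivAt_pow 2 s).const_mul ε).const_add 1
  have h2 : HasDerivAt (smoothTruncation ε) _ s := (hasDerivAt_id s).div h1 hpos.ne'
  have hs := mul_nonneg hε (sq_nonneg s)
  rw [h2.deriv, abs_div, abs_of_pos (pow_pos hpos 2), div_le_one (pow_pos hpos 2)]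
  simp only [id]
  rw [abs_le]
  constructor <;> nlinarith

theorem tendsto_smoothTruncation (s : ℝ) :
    Tendsto (fun k : ℕ => smoothTruncation ((k : ℝ) + 1)⁻¹ s) atTop (𝓝 s) := by
  have h1 : Tendsto (fun k : ℕ => ((k : ℝ) + 1)⁻¹) atTop (𝓝 0) := by
    simpa [one_div] using tendsto_one_div_add_atTop_nhds_zero_nat (𝕜 := ℝ)
  have h2 : Tendsto (fun k : ℕ => 1 + ((k : ℝ) + 1)⁻¹ * s ^ 2) atTop (𝓝 (1 + 0 * s ^ 2)) :=
    (h1.mul_const _).const_add 1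
  have h3 : Tendsto (fun k : ℕ => s / (1 + ((k : ℝ) + 1)⁻¹ * s ^ 2)) atTop
      (𝓝 (s / (1 + 0 * s ^ 2))) := tendsto_const_nhds.div h2 (by simp)
  simpa [smoothTruncation] using h3

/-- A Poincaré-type inequality with weight `B` passes from bounded functions of mean zero to all
functions of mean zero: truncate smoothly and subtract the mean. -/
theorem poincare_of_bounded (hω : IsOpen ω) {B : USphere (n + 1) → ℝ} {c : ℝ}
    (hBc : ContinuousOn B ω) (hBpos : ∀ θ ∈ ω, 0 < B θ)
    (hBi : IntegrableOn B ω (surfaceMeasure (n + 1)))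
    (hb : 0 < ∫ θ in ω, B θ ∂(surfaceMeasure (n + 1)))
    (hbdd : ∀ (U : Euc (n + 1) → ℝ) (M : ℝ), ContDiffOn ℝ 1 U (coneOver ω) →
      (∀ x ∈ coneOver ω, ∀ r : ℝ, 0 < r → U (r • x) = U x) → (∀ x ∈ coneOver ω, |U x| ≤ M) →
      IntegrableOn (fun θ : USphere (n + 1) => U θ * B θ) ω (surfaceMeasure (n + 1)) →
      ∫ θ in ω, U θ * B θ ∂(surfaceMeasure (n + 1)) = 0 →
      IntegrableOn (fun θ : USphere (n + 1) => U θ ^ 2 * B θ) ω (surfaceMeasure (n + 1)) →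
      IntegrableOn (fun θ : USphere (n + 1) => ‖gradient U θ‖ ^ 2 * B θ) ω
        (surfaceMeasure (n + 1)) →
      c * ∫ θ in ω, U θ ^ 2 * B θ ∂(surfaceMeasure (n + 1)) ≤
        ∫ θ in ω, ‖gradient U θ‖ ^ 2 * B θ ∂(surfaceMeasure (n + 1)))
    {U : Euc (n + 1) → ℝ} (hU : ContDiffOn ℝ 1 U (coneOver ω))
    (hUhom : ∀ x ∈ coneOver ω, ∀ r : ℝ, 0 < r → U (r • x) = U x)
    (hUB : IntegrableOn (fun θ : USphere (n + 1) => U θ * B θ) ω (surfaceMeasure (n + 1)))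
    (hUB0 : ∫ θ in ω, U θ * B θ ∂(surfaceMeasure (n + 1)) = 0)
    (hU2 : IntegrableOn (fun θ : USphere (n + 1) => U θ ^ 2 * B θ) ω (surfaceMeasure (n + 1)))
    (hD : IntegrableOn (fun θ : USphere (n + 1) => ‖gradient U θ‖ ^ 2 * B θ) ω
      (surfaceMeasure (n + 1))) :
    c * ∫ θ in ω, U θ ^ 2 * B θ ∂(surfaceMeasure (n + 1)) ≤
      ∫ θ in ω, ‖gradient U θ‖ ^ 2 * B θ ∂(surfaceMeasure (n + 1)) := by
  have hΩ := isOpen_coneOver hω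
  have hmem : ∀ {θ : USphere (n + 1)}, θ ∈ ω → (θ : Euc (n + 1)) ∈ coneOver ω :=
    fun hθ => (coe_mem_coneOver _).2 hθ
  have hres : ∀ {f : Euc (n + 1) → ℝ}, ContinuousOn f (coneOver ω) →
      ContinuousOn (fun θ : USphere (n + 1) => f θ) ω := fun hf =>
    hf.comp (by fun_prop) fun θ hθ => hmem hθ
  set b := ∫ θ in ω, B θ ∂(surfaceMeasure (n + 1)) with hbdef
  let e : ℕ → ℝ := fun k => ((k : ℝ) + 1)⁻¹
  have he0 : ∀ k, 0 < e k := fun k => by simp only [e]; positivity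
  have he1 : ∀ k, e k ≤ 1 := fun k => inv_le_one_of_one_le₀ (by
    have : (0 : ℝ) ≤ k := k.cast_nonneg
    linarith)
  let T : ℕ → Euc (n + 1) → ℝ := fun k x => smoothTruncation (e k) (U x)
  have hTd : ∀ k, ContDiffOn ℝ 1 (T k) (coneOver ω) := fun k =>
    (contDiff_smoothTruncation (he0 k).le).comp_contDiffOn hU
  have hTc : ∀ k, ContinuousOn (fun θ : USphere (n + 1) => T k θ) ω := fun k =>
    hres (hTd k).continuousOn
  have hTle : ∀ k x, |T k x| ≤ |U x| := fun k x => abs_smoothTruncation_le (he0 k).le _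
  have hmT1 : ∀ k, AEStronglyMeasurable (fun θ : USphere (n + 1) => T k θ * B θ)
      ((surfaceMeasure (n + 1)).restrict ω) := fun k =>
    ((hTc k).mul hBc).aestronglyMeasurable hω.measurableSet
  have hmT2 : ∀ k, AEStronglyMeasurable (fun θ : USphere (n + 1) => T k θ ^ 2 * B θ)
      ((surfaceMeasure (n + 1)).restrict ω) := fun k =>
    (((hTc k).pow 2).mul hBc).aestronglyMeasurable hω.measurableSet
  have hb1 : ∀ k, ∀ᵐ θ : USphere (n + 1) ∂((surfaceMeasure (n + 1)).restrict ω),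
      ‖T k (θ : Euc (n + 1)) * B θ‖ ≤ ‖U θ * B θ‖ := fun k => by
    refine Eventually.of_forall fun θ => ?_
    rw [norm_mul, norm_mul]
    gcongr
    exact hTle k θ
  have hb2 : ∀ k, ∀ᵐ θ : USphere (n + 1) ∂((surfaceMeasure (n + 1)).restrict ω),
      ‖T k (θ : Euc (n + 1)) ^ 2 * B θ‖ ≤ ‖U θ ^ 2 * B θ‖ := fun k => by
    refine Eventually.of_forall fun θ => ?_
    rw [norm_mul, norm_mul, norm_pow, norm_pow]
    gcongr
    exact hTle k θ
  have hi1 : ∀ k, IntegrableOn (fun θ : USphere (n + 1) => T k θ * B θ) ω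
      (surfaceMeasure (n + 1)) := fun k => Integrable.mono hUB (hmT1 k) (hb1 k)
  have hi2 : ∀ k, IntegrableOn (fun θ : USphere (n + 1) => T k θ ^ 2 * B θ) ω
      (surfaceMeasure (n + 1)) := fun k => Integrable.mono hU2 (hmT2 k) (hb2 k)
  let m : ℕ → ℝ := fun k => (∫ θ in ω, T k θ * B θ ∂(surfaceMeasure (n + 1))) / b
  -- the inequality for the truncated functions
  have hk : ∀ k, c * (∫ θ in ω, T k θ ^ 2 * B θ ∂(surfaceMeasure (n + 1)) - m k ^ 2 * b) ≤
      ∫ θ in ω, ‖gradient U θ‖ ^ 2 * B θ ∂(surfaceMeasure (n + 1)) := by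
    intro k
    have hmk : ∫ θ in ω, T k θ * B θ ∂(surfaceMeasure (n + 1)) = m k * b :=
      (div_mul_cancel₀ _ hb.ne').symm
    have hgd : ∀ θ ∈ ω, ‖gradient (fun x => T k x - m k) (θ : Euc (n + 1))‖ ≤
        ‖gradient U (θ : Euc (n + 1))‖ := by
      intro θ hθ
      have h1 := ((hU.contDiffAt (hΩ.mem_nhds (hmem hθ))).differentiableAt
        one_ne_zero).hasFDerivAt
      have h2 := ((contDiff_smoothTruncation (he0 k).le).differentiable one_ne_zero
        (U θ)).hasDerivAt
      have h3 : fderiv ℝ (fun x => T k x - m k) (θ : Euc (n + 1)) = _ :=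
        ((h2.comp_hasFDerivAt (θ : Euc (n + 1)) h1).sub_const (m k)).fderiv
      rw [norm_gradient_eq_norm_fderiv, norm_gradient_eq_norm_fderiv, h3, norm_smul]
      exact mul_le_of_le_one_left (norm_nonneg _)
        (abs_deriv_smoothTruncation_le (he0 k).le _)
    have hd' : ContDiffOn ℝ 1 (fun x => T k x - m k) (coneOver ω) :=
      (hTd k).sub contDiffOn_const
    have hgc : ContinuousOn (fun θ : USphere (n + 1) =>
        ‖gradient (fun x => T k x - m k) (θ : Euc (n + 1))‖ ^ 2 * B θ) ω := by
      simp_rw [norm_gradient_eq_norm_fderiv]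
      exact ((hres (hd'.continuousOn_fderiv_of_isOpen hΩ le_rfl).norm).pow 2).mul hBc
    have hgi : IntegrableOn (fun θ : USphere (n + 1) =>
        ‖gradient (fun x => T k x - m k) (θ : Euc (n + 1))‖ ^ 2 * B θ) ω
        (surfaceMeasure (n + 1)) := by
      refine Integrable.mono hD (hgc.aestronglyMeasurable hω.measurableSet) ?_
      filter_upwards [ae_restrict_mem hω.measurableSet] with θ hθ
      rw [norm_mul, norm_mul, norm_pow, norm_pow, norm_norm, norm_norm]
      gcongr
      exact hgd θ hθ
    have e1 : (fun θ : USphere (n + 1) => (T k θ - m k) * B θ) =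
        fun θ : USphere (n + 1) => T k θ * B θ - m k * B θ := by
      ext θ; ring
    have e2 : (fun θ : USphere (n + 1) => (T k θ - m k) ^ 2 * B θ) =
        fun θ : USphere (n + 1) => T k θ ^ 2 * B θ - (2 * m k) * (T k θ * B θ) +
          m k ^ 2 * B θ := by
      ext θ; ring
    have i3 : IntegrableOn (fun θ : USphere (n + 1) => T k θ ^ 2 * B θ -
      (2 * m k) * (T k θ * B θ)) ω (surfaceMeasure (n + 1)) := (hi2 k).sub ((hi1 k).const_mul _)
    have hmain := hbdd (fun x => T k x - m k) ((e k)⁻¹ + |m k|) hd'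
      (fun x hx r hr => by simp only [T, hUhom x hx r hr])
      (fun x _ => (abs_sub _ _).trans
        (add_le_add_left (abs_smoothTruncation_le_inv (he0 k) (he1 k) _) _))
      (by rw [e1]; exact (hi1 k).sub (hBi.const_mul _))
      (by rw [e1, integral_sub (hi1 k) (hBi.const_mul _), integral_const_mul, hmk, sub_self])
      (by rw [e2]; exact i3.add (hBi.const_mul _)) hgi
    rw [e2, integral_add i3 (hBi.const_mul _), integral_sub (hi2 k) ((hi1 k).const_mul _),
      integral_const_mul, integral_const_mul, hmk, ← hbdef] at hmain
    refine (le_of_eq ?_).trans (hmain.trans ?_)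
    · ring
    · refine setIntegral_mono_on hgi hD hω.measurableSet fun θ hθ => ?_
      have := (hBpos θ hθ).le
      gcongr
      exact hgd θ hθ
  have hlim2 : Tendsto (fun k => ∫ θ in ω, T k θ ^ 2 * B θ ∂(surfaceMeasure (n + 1))) atTop
      (𝓝 (∫ θ in ω, U θ ^ 2 * B θ ∂(surfaceMeasure (n + 1)))) :=
    tendsto_integral_of_dominated_convergence _ hmT2 hU2.norm hb2
      (Eventually.of_forall fun θ => ((tendsto_smoothTruncation (U θ)).pow 2).mul_const _)
  have hlim1 : Tendsto (fun k => ∫ θ in ω, T k θ * B θ ∂(surfaceMeasure (n + 1))) atTop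
      (𝓝 0) := by
    rw [← hUB0]
    exact tendsto_integral_of_dominated_convergence _ hmT1 hUB.norm hb1
      (Eventually.of_forall fun θ => (tendsto_smoothTruncation (U θ)).mul_const _)
  have hfin := (hlim2.sub (((hlim1.div_const b).pow 2).mul_const b)).const_mul c
  rw [zero_div, zero_pow two_ne_zero, zero_mul, sub_zero] at hfin
  exact le_of_tendsto hfin (Eventually.of_forall hk)

/-! ### The eigenvalue estimate -/

theorem radialMass_eq_mul {φ : Euc (n + 1) → ℝ} {θ₀ θ : USphere (n + 1)} {b : ℝ}
    (h : ∀ r : ℝ, 0 < r → φ (r • (θ : Euc (n + 1))) = φ (r • (θ₀ : Euc (n + 1))) * b) {r : ℝ}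
    (hr : 0 < r) : radialMass φ r θ = radialMass φ r θ₀ * b := by
  rw [radialMass, radialMass, intervalIntegral.integral_of_le hr.le,
    intervalIntegral.integral_of_le hr.le, ← integral_mul_const]
  refine setIntegral_congr_fun measurableSet_Ioc fun s hs => ?_
  rw [radialDensity, radialDensity, h s hs.1, mul_assoc]

/-- The second variation as a bound for the first nontrivial Neumann eigenvalue. -/
theorem le_neumannEigenvalue (hω : IsOpen ω) {φ : Euc (n + 1) → ℝ}
    (hφ : ContDiffOn ℝ 1 φ (coneOver ω)) (hφc : ContinuousOn φ (closure (coneOver ω)))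
    (hφpos : ∀ x ∈ coneOver ω, 0 < φ x) {R : ℝ} (hR : 0 < R)
    (hiso : isoperimetricProfile φ (coneOver ω)
          (weightedMeasure φ (coneOver ω) (ball 0 R ∩ coneOver ω)) =
        weightedPerimeter φ (ball 0 R ∩ coneOver ω) (coneOver ω))
    {a l G : ℝ → ℝ} {l' : ℝ} {B : USphere (n + 1) → ℝ}
    (hdens : ∀ r, 0 < r → ∀ θ ∈ ω, radialDensity φ r θ = a r * B θ)
    (hmass : ∀ r, 0 < r → ∀ θ ∈ ω, radialMass φ r θ = G r * B θ)
    (hapos : ∀ r, 0 < r → 0 < a r) (hG : ∀ r, 0 < r → HasDerivAt G (a r) r)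
    (hal : ∀ r, 0 < r → HasDerivAt a (a r * l r) r) (hl : HasDerivAt l l' R)
    (hBpos : ∀ θ ∈ ω, 0 < B θ) (hBc : ContinuousOn B ω)
    (hBi : IntegrableOn B ω (surfaceMeasure (n + 1))) :
    ((-R ^ 2 * l' : ℝ) : EReal) ≤ (neumannEigenvalue B ω : EReal) := by
  rcases le_or_gt (-R ^ 2 * l') 0 with hneg | hposl
  · refine le_trans ?_ (EReal.coe_ennreal_nonneg _)
    exact_mod_cast hneg
  rw [← max_eq_left hposl.le, ← EReal.coe_ennreal_ofReal, EReal.coe_ennreal_le_coe_ennreal_iff]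
  refine le_iInf₂ fun u hu => ?_
  obtain ⟨hu1, hu2, hu3, hu4, θ₁, hθ₁, huθ₁⟩ := hu
  have hΩ := isOpen_coneOver hω
  set U := homogeneousExt u with hUdef
  have hU : ContDiffOn ℝ 1 U (coneOver ω) := contDiffOn_homogeneousExt hω hu1
  have hUu : ∀ θ : USphere (n + 1), U θ = u θ := homogeneousExt_coe u
  have hmem : ∀ {θ : USphere (n + 1)}, θ ∈ ω → (θ : Euc (n + 1)) ∈ coneOver ω :=
    fun hθ => (coe_mem_coneOver _).2 hθ
  have hpos_int : ∀ {g : USphere (n + 1) → ℝ}, ContinuousOn g ω → (∀ θ ∈ ω, 0 ≤ g θ) →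
      IntegrableOn g ω (surfaceMeasure (n + 1)) → 0 < g θ₁ →
      0 < ∫ θ in ω, g θ ∂(surfaceMeasure (n + 1)) := by
    intro g hg hg0 hgi hg1
    rw [setIntegral_pos_iff_support_of_nonneg_ae _ hgi]
    · refine ((hg.isOpen_inter_preimage hω isOpen_Ioi).measure_pos _ ⟨θ₁, hθ₁, hg1⟩).trans_le
        (measure_mono fun θ hθ => ⟨ne_of_gt hθ.2, hθ.1⟩)
    · filter_upwards [ae_restrict_mem hω.measurableSet] with θ hθ using hg0 θ hθ
  have huc : ContinuousOn u ω := by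
    have : ContinuousOn (fun θ : USphere (n + 1) => U θ) ω :=
      hU.continuousOn.comp (by fun_prop) fun θ hθ => hmem hθ
    simpa only [hUu] using this
  have hden : 0 < ∫ θ in ω, u θ ^ 2 * B θ ∂(surfaceMeasure (n + 1)) :=
    hpos_int ((huc.pow 2).mul hBc) (fun θ hθ => mul_nonneg (sq_nonneg _) (hBpos θ hθ).le) hu2
      (mul_pos (by positivity) (hBpos θ₁ hθ₁))
  have hb : 0 < ∫ θ in ω, B θ ∂(surfaceMeasure (n + 1)) :=
    hpos_int hBc (fun θ hθ => (hBpos θ hθ).le) hBi (hBpos θ₁ hθ₁)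
  rw [← ofReal_integral_eq_lintegral_ofReal hu2 (by
    filter_upwards [ae_restrict_mem hω.measurableSet] with θ hθ
    exact mul_nonneg (sq_nonneg _) (hBpos θ hθ).le)]
  rw [ENNReal.le_div_iff_mul_le (Or.inl (ENNReal.ofReal_pos.2 hden).ne')
    (Or.inl ENNReal.ofReal_ne_top), ← ENNReal.ofReal_mul hposl.le]
  by_cases htop : ∫⁻ θ in ω, ENNReal.ofReal (‖sphericalGradient u θ‖ ^ 2 * B θ)
      ∂(surfaceMeasure (n + 1)) = ⊤
  · -- an infinite Dirichlet integral
    rw [htop]; exact le_top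
  have hgc : ContinuousOn (fun θ : USphere (n + 1) =>
      ‖gradient U (θ : Euc (n + 1))‖ ^ 2 * B θ) ω := by
    simp_rw [norm_gradient_eq_norm_fderiv]
    exact (((hU.continuousOn_fderiv_of_isOpen hΩ le_rfl).comp (by fun_prop)
      fun θ hθ => hmem hθ).norm.pow 2).mul hBc
  have hg0 : 0 ≤ᵐ[(surfaceMeasure (n + 1)).restrict ω] fun θ : USphere (n + 1) =>
      ‖gradient U (θ : Euc (n + 1))‖ ^ 2 * B θ := by
    filter_upwards [ae_restrict_mem hω.measurableSet] with θ hθ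
    exact mul_nonneg (sq_nonneg _) (hBpos θ hθ).le
  have hD : IntegrableOn (fun θ : USphere (n + 1) => ‖gradient U θ‖ ^ 2 * B θ) ω
      (surfaceMeasure (n + 1)) := by
    refine ⟨hgc.aestronglyMeasurable hω.measurableSet, ?_⟩
    rw [hasFiniteIntegral_iff_ofReal hg0]
    exact lt_top_iff_ne_top.2 htop
  have hfinal := poincare_of_bounded hω hBc hBpos hBi hb (c := -R ^ 2 * l')
    (fun V M hV hVh hVM i1 i2 i3 i4 => second_variation_of_bounded hω hφ hφc hφpos hR hiso hdens
      hmass hapos hG hal hl hBpos hBi hV hVh hVM i1 i2 i3 i4) hU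
    (fun x _ r hr => homogeneousExt_smul u hr x) (by simpa only [hUu] using hu3)
    (by simpa only [hUu] using hu4) (by simpa only [hUu] using hu2) hD
  simp only [hUu] at hfinal
  refine (ENNReal.ofReal_le_ofReal hfinal).trans (le_of_eq ?_)
  exact ofReal_integral_eq_lintegral_ofReal hD hg0

/-- The dimension is `N = n + 1`. -/
theorem theorem2p1 (n : ℕ) (ω : Set (USphere (n + 1))) (hω : IsOpen ω)
    (φ : Euc (n + 1) → ℝ)
    (hφ1 : ContDiffOn ℝ 1 φ (coneOver ω))
    (hφc : ContinuousOn φ (closure (coneOver ω)))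
    (hφpos : ∀ x ∈ coneOver ω, 0 < φ x)
    (hiso : ∀ R : ℝ, 0 < R →
      isoperimetricProfile φ (coneOver ω)
          (weightedMeasure φ (coneOver ω) (ball 0 R ∩ coneOver ω)) =
        weightedPerimeter φ (ball 0 R ∩ coneOver ω) (coneOver ω)) :
    ∃ (A : ℝ → ℝ) (B : USphere (n + 1) → ℝ),
      ContDiffOn ℝ 1 A (Ioi 0) ∧ ContinuousOn A (Ici 0) ∧ (∀ r : ℝ, 0 < r → 0 < A r) ∧
      ContMDiffOn (𝓡 n) 𝓘(ℝ, ℝ) 1 B ω ∧ (∀ θ ∈ ω, 0 < B θ) ∧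
      (∀ r : ℝ, 0 < r → ∀ θ ∈ ω, φ (r • (θ : Euc (n + 1))) = A r * B θ) ∧
      (ContDiffOn ℝ 2 φ (coneOver ω) →
        ContDiffOn ℝ 2 A (Ioi 0) ∧
        ∀ r : ℝ, 0 < r →
          ((((n + 1 : ℕ) : ℝ) - 1 +
              r ^ 2 * ((deriv A r) ^ 2 / (A r) ^ 2 - deriv (deriv A) r / A r) : ℝ) : EReal) ≤
            (neumannEigenvalue B ω : EReal)) := by
  rcases ω.eq_empty_or_nonempty with rfl | ⟨θ₀, hθ₀⟩
  · -- over the empty set the eigenvalue is the infimum of the empty set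
    refine ⟨fun _ => 1, fun _ => 1, contDiffOn_const, continuousOn_const, fun _ _ => one_pos,
      fun θ hθ => hθ.elim, fun _ _ => one_pos, fun _ _ θ hθ => hθ.elim,
      fun _ => ⟨contDiffOn_const, fun r _ => ?_⟩⟩
    have : neumannEigenvalue (n := n) (fun _ => 1) ∅ = ⊤ :=
      iInf₂_eq_top.2 fun u hu => by
        obtain ⟨-, -, -, -, θ, hθ, -⟩ := hu
        exact hθ.elim
    rw [this]
    exact le_top
  have hray : ∀ {k : WithTop ℕ∞}, ContDiffOn ℝ k φ (coneOver ω) →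
      ContDiffOn ℝ k (fun r : ℝ => φ (r • (θ₀ : Euc (n + 1)))) (Ioi 0) := fun h =>
    h.comp (by fun_prop) fun r hr => (smul_mem_coneOver hr θ₀).2 hθ₀
  have hφθ₀ : 0 < φ (θ₀ : Euc (n + 1)) := hφpos _ ((coe_mem_coneOver θ₀).2 hθ₀)
  have hApos : ∀ r : ℝ, 0 < r → 0 < φ (r • (θ₀ : Euc (n + 1))) := fun r hr =>
    hφpos _ ((smul_mem_coneOver hr θ₀).2 hθ₀)
  have hBpos : ∀ θ ∈ ω, 0 < φ (θ : Euc (n + 1)) / φ (θ₀ : Euc (n + 1)) := fun θ hθ =>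
    div_pos (hφpos _ ((coe_mem_coneOver θ).2 hθ)) hφθ₀
  have hprod : ∀ r : ℝ, 0 < r → ∀ θ ∈ ω, φ (r • (θ : Euc (n + 1))) =
      φ (r • (θ₀ : Euc (n + 1))) * (φ (θ : Euc (n + 1)) / φ (θ₀ : Euc (n + 1))) := fun r hr θ hθ =>
    eq_mul_div_of_isoperimetric hω hφ1 hφc hφpos hiso hθ₀ hθ hr
  have hmaps : MapsTo (fun θ : USphere (n + 1) => (θ : Euc (n + 1))) ω (coneOver ω) :=
    fun θ hθ => (coe_mem_coneOver θ).2 hθ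
  refine ⟨fun r => φ (r • (θ₀ : Euc (n + 1))),
    fun θ => φ (θ : Euc (n + 1)) / φ (θ₀ : Euc (n + 1)), hray hφ1,
    hφc.comp (by fun_prop) fun r hr => smul_mem_closure_coneOver hθ₀ hr, hApos, ?_, hBpos, hprod,
    fun hφ2 => ⟨hray hφ2, fun R hR => ?_⟩⟩
  · have : Fact (Module.finrank ℝ (Euc (n + 1)) = n + 1) := Fact.mk finrank_euclideanSpace_fin
    have h1 : ContMDiffOn (𝓡 n) 𝓘(ℝ, ℝ) 1 (fun θ : USphere (n + 1) => φ (θ : Euc (n + 1))) ω :=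
      hφ1.contMDiffOn.comp (contMDiff_coe_sphere (n := n)).contMDiffOn hmaps
    have h2 : ContDiff ℝ 1 fun s : ℝ => s / φ (θ₀ : Euc (n + 1)) := contDiff_id.div_const _
    exact h2.contMDiff.comp_contMDiffOn h1
  · set A : ℝ → ℝ := fun r => φ (r • (θ₀ : Euc (n + 1))) with hA
    have hA2 : ContDiffOn ℝ 2 A (Ioi 0) := hray hφ2
    have hA' : ∀ r, 0 < r → HasDerivAt A (deriv A r) r := fun r hr =>
      ((hA2.contDiffAt (Ioi_mem_nhds hr)).differentiableAt two_ne_zero).hasDerivAt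
    have hA'' : HasDerivAt (deriv A) (deriv (deriv A) R) R := by
      have h1 : ContDiffOn ℝ 1 (deriv A) (Ioi 0) :=
        ((contDiffOn_succ_iff_deriv_of_isOpen (n := 1) isOpen_Ioi).1
          (by simpa [one_add_one_eq_two] using hA2)).2.2
      exact ((h1.contDiffAt (Ioi_mem_nhds hR)).differentiableAt one_ne_zero).hasDerivAt
    have hARp : 0 < A R := hApos R hR
    obtain ⟨C, hC0, hC⟩ := exists_bound_on_ray hφc 1
    have hBc : ContinuousOn (fun θ : USphere (n + 1) => φ (θ : Euc (n + 1)) /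
        φ (θ₀ : Euc (n + 1))) ω := (hφ1.continuousOn.comp (by fun_prop) hmaps).div_const _
    have hBi : IntegrableOn (fun θ : USphere (n + 1) => φ (θ : Euc (n + 1)) /
        φ (θ₀ : Euc (n + 1))) ω (surfaceMeasure (n + 1)) := by
      refine Integrable.of_bound (hBc.aestronglyMeasurable hω.measurableSet)
        (C / φ (θ₀ : Euc (n + 1))) ?_
      filter_upwards [ae_restrict_mem hω.measurableSet] with θ hθ
      rw [norm_div, Real.norm_of_nonneg hφθ₀.le]
      gcongr
      simpa using hC θ hθ 1 ⟨zero_le_one, le_rfl⟩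
    have key := le_neumannEigenvalue hω hφ1 hφc hφpos hR (hiso R hR)
      (a := fun r => radialDensity φ r θ₀) (l := fun r => n / r + deriv A r / A r)
      (G := fun r => radialMass φ r θ₀)
      (fun r hr θ hθ => by rw [radialDensity, radialDensity, hprod r hr θ hθ, mul_assoc])
      (fun r hr θ hθ => radialMass_eq_mul (fun s hs => hprod s hs θ hθ) hr)
      (fun r hr => radialDensity_pos hφpos hθ₀ hr)
      (fun r hr => hasDerivAt_radialMass hφc hθ₀ hr)
      (fun r hr => by
        have h1 := (hasDerivAt_pow n r).mul (hA' r hr)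
        have h2 : A r ≠ 0 := (hApos r hr).ne'
        refine h1.congr_deriv ?_
        have h3 : radialDensity φ r θ₀ = r ^ n * A r := rfl
        rw [h3]
        rcases n with _ | m
        · field_simp
          simp
        · rw [Nat.add_sub_cancel, pow_succ]
          field_simp)
      (((hasDerivAt_id R).fun_inv hR.ne' |>.const_mul (n : ℝ)).add (hA''.div (hA' R hR) hARp.ne'))
      hBpos hBc hBi
    refine le_trans (le_of_eq ?_) key
    congr 1
    push_cast
    have := hR.ne'
    simp only [id]
    field_simp
    ring
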